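/- A self-delimiting Turing machine $T$ has a finite control and three tapes with cells containing $0$, $1$ or blank: a one-way, read-only program tape containing a bit string $p$ (followed by blanks), a two-way read/write work tape initially containing an auxiliary bit string $y$, and a one-way, write-only output tape, initially empty. The program head starts in front of the first cell. One writes $T(p,y)=x$ if $T$, started with $p$ and $y$, halts after finitely many steps with the program head on the last bit of $p$ (so that exactly $p$ has been scanned, and nothing beyond it) and with the string $x$ on the output tape; otherwise $T(p,y)$ is undefined. A self-delimiting machine $U$ is universal if for every self-delimiting machine $T$ there is a bit string $r$ with $U(rq,y)=T(q,y)$ for all bit strings $q,y$ (both sides being defined or both undefined). Fix a universal self-delimiting machine $U$ and, for $x,y\in\{0,1\}^*$, let $$K(x\mid y)=\min\{|p| : U(p,y)=x\},\qquad P(x\mid y)=\sum_{p\,:\,U(p,y)=x}2^{-|p|}.$$ **Theorem (The Coding Theorem).** For all $x,y\in\{0,1\}^*$, $$K(x\mid y)=-\log_2 P(x\mid y)+O(1).$$ That is, there is a constant $c$, depending only on $U$, such that for all $x,y\in\{0,1\}^*$ the quantity $K(x\mid y)$ is finite, $0<P(x\mid y)<\infty$, and $\bigl|K(x\mid y)+\log_2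 P(x\mid y)\bigr|\le c$. -/

import Mathlib

open scoped ENNReal

/-- The elementary operations of a self-delimiting Turing machine; one is performed per step.
Tape symbols are elements of `Option Bool`, where `none` is the blank. -/
inductive SDAction : Type where
  /-- The head of the (one-way, read-only) program tape moves one cell to the right and
  scans that cell. -/
  | scan : SDAction
  /-- The head of the (two-way) work tape moves one cell to the left or to the right. -/
  | move : Turing.Dir → SDAction
  /-- The scanned cell of the work tape is overwritten. -/
  | write : Option Bool → SDAction
  /-- A bit is appended to the (one-way, write-only) output tape. -/
  | out : Bool → SDAction

/-- A self-delimiting Turing machine: a finite control driving a program tape, a work tape and an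
output tape. `rule q s w` is the operation performed, and the state entered, in state `q` when `s`
is scanned on the program tape and `w` on the work tape; the machine halts when no rule is
given. -/
structure SDMachine : Type 1 where
  Q : Type
  finite_Q : Finite Q
  start : Q
  rule : Q → Option Bool → Option Bool → Option (SDAction × Q)

namespace SDMachine

/-- Configurations: the control state, the number of cells of the program tape scanned so far,
the work tape, and the string written on the output tape so far. -/
structure Cfg (T : SDMachine) : Type where
  state : T.Q
  pos : ℕ
  work : Turing.Tape (Option Bool)
  output : List Bool

/-- The program-tape symbol under the head after `n` cells have been scanned, when the tape
contains the program `p` followed by blanks. The head starts in front of the first cell. -/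
def scanned (p : List Bool) : ℕ → Option Bool
  | 0 => none
  | n + 1 => p[n]?

/-- The initial configuration: nothing has been scanned, the work tape contains `y`, with the head
on its first cell, and the output tape is empty. -/
def init (T : SDMachine) (y : List Bool) : T.Cfg :=
  ⟨T.start, 0, Turing.Tape.mk₁ (y.map some), []⟩

/-- The effect of one operation, followed by a change of state. -/
def act (T : SDMachine) (c : T.Cfg) : SDAction → T.Q → T.Cfg
  | .scan, q => ⟨q, c.pos + 1, c.work, c.output⟩
  | .move d, q => ⟨q, c.pos, c.work.move d, c.output⟩
  | .write s, q => ⟨q, c.pos, c.work.write s, c.output⟩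
  | .out b, q => ⟨q, c.pos, c.work, c.output ++ [b]⟩

/-- One step of the machine with `p` on its program tape; `none` means that it has halted. -/
def step (T : SDMachine) (p : List Bool) (c : T.Cfg) : Option T.Cfg :=
  (T.rule c.state (scanned p c.pos) c.work.head).map fun a => T.act c a.1 a.2

/-- The partial function `(p, y) ↦ T(p, y)`. It is defined when `T`, with program tape `p` and
auxiliary string `y` on the work tape, halts with the head of the program tape on the last bit of
`p` (that is, having scanned all of `p` and nothing more); its value is then the string on the
output tape. -/
noncomputable def run (T : SDMachine) (p y : List Bool) : Part (List Bool) :=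
  (StateTransition.eval (T.step p) (T.init y)).bind fun c =>
    Part.assert (c.pos = p.length) fun _ => Part.some c.output

/-- `U` is universal: every self-delimiting machine `T` is simulated by `U` after a fixed preamble
`r`, that is, `U(rq, y) = T(q, y)` for all `q` and `y`, both sides being defined or both not. -/
def IsUniversal (U : SDMachine) : Prop :=
  ∀ T : SDMachine, ∃ r : List Bool, ∀ q y : List Bool, U.run (r ++ q) y = T.run q y

/-- The conditional prefix complexity `K_U(x | y) = min {|p| : U(p, y) = x}`, which is `⊤` when
there is no such `p`. -/
noncomputable def K (U : SDMachine) (x y : List Bool) : ℕ∞ :=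
  ⨅ p : {p : List Bool // x ∈ U.run p y}, (p.1.length : ℕ∞)

/-- The conditional universal probability `P_U(x | y)`, the sum of `2^{-|p|}` over all `p` with
`U(p, y) = x`. -/
noncomputable def P (U : SDMachine) (x y : List Bool) : ℝ≥0∞ :=
  ∑' p : {p : List Bool // x ∈ U.run p y}, (2 : ℝ≥0∞)⁻¹ ^ p.1.length

end SDMachine

/-! One inequality is immediate: a shortest program alone contributes `2^{-K}` to `P`. For the
other, it suffices to build a single machine `T` having programs for `x` about as short as `-log₂
P(x | y)`; universality of `U` then costs only the length of a fixed preamble `r`.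

The number `outCount / 2^t` is the measure of the infinite program tapes on which `U` halts within
`t` steps with a given output. It grows with `t`, its sum over all outputs is at most 1, and,
halting programs being prefix-free, it eventually dominates every finite part of the sum `P`
(`exists_sum_le_outCount`). Rounded down to a power of two (`level`), it can only change by at least
doubling. The increments, called events, have total weight at most 1 (`weightBelow_le_one`), and the
event at which a level is first reached carries at least half of that level, hence a quarter of the
measure (`exists_outCount_le_eventWeight`).

The events are laid out as consecutive intervals in `[0, 1]`, in the manner of Shannon and Fano.
Each nonempty interval contains a dyadic cylinder of at least a quarter of its length
(`exists_cylinder`). `T` reads bits until the cylinder of what it has read fits into one interval,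
and prints the output of that event (`exists_decodeStep_of_cylinder`). The loss is a factor `4 * 4 =
16`, so the constant is `|r| + 4`.

The rest shows that `T` exists in this machine model. Bounded runs of `U` are primitive recursive,
so `decodeStep` is partial recursive; Mathlib's compiler turns it into a machine with four stacks,
and these are interleaved on one work tape (`exists_machine_of_partrec`). Only one direction of this
simulation is needed: `T` must print `x` on the chosen programs, and its behaviour on all others is
irrelevant. -/

open Turing StateTransition

/-! ### Stack programs and their compilation to self-delimiting machines -/

/-- The tape with the cells `l` (read leftwards) to the left of the head and the cells `r` from the
head on. -/
def listTape (l r : List (Option Bool)) : Tape (Option Bool) :=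
  Tape.mk' (ListBlank.mk l) (ListBlank.mk r)

namespace listTape

variable (l r : List (Option Bool)) (a b : Option Bool)

@[simp] theorem head_cons : (listTape l (a :: r)).head = a := by
  simp [listTape, Tape.mk']

@[simp] theorem head_nil : (listTape l []).head = none := by
  simp [listTape, Tape.mk']; rfl

@[simp] theorem move_right_cons : (listTape l (a :: r)).move Dir.right = listTape (a :: l) r := by
  simp [listTape, Tape.move_right_mk']

@[simp] theorem move_left_cons : (listTape (a :: l) r).move Dir.left = listTape l (a :: r) := by
  simp [listTape, Tape.move_left_mk']

@[simp] theorem move_left_nil : (listTape [] r).move Dir.left = listTape [] (none :: r) := by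
  simp [listTape, Tape.move_left_mk']; rfl

@[simp] theorem write_cons : (listTape l (a :: r)).write b = listTape l (b :: r) := by
  simp [listTape, Tape.write_mk']

theorem concat_none : listTape l (r ++ [none]) = listTape l r := by
  have : ListBlank.mk (r ++ [none]) = ListBlank.mk r :=
    (Quotient.sound' (Or.inl ⟨1, rfl⟩ : BlankRel r (r ++ [none]))).symm
  rw [listTape, this, listTape]

theorem nil_eq : listTape l [] = listTape l [none] := (concat_none l []).symm

end listTape

/-- The instructions of a stack program. Besides its stacks, the program has a reserve of bits which
it can only consume, from the end, by `fetch`. -/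
inductive StackInstr (K Γ S : Type) : Type where
  | push : K → Γ → S → StackInstr K Γ S
  | read : K → Bool → (Option Γ → S) → StackInstr K Γ S
  | scan : (Option Bool → S) → StackInstr K Γ S
  | out : Bool → S → StackInstr K Γ S
  | nop : S → StackInstr K Γ S
  | fetch : (Option Bool → S) → StackInstr K Γ S
  | halt : StackInstr K Γ S

/-- Configurations of a stack program. -/
structure StackCfg (K Γ S : Type) : Type where
  state : S
  pos : ℕ
  stk : K → List Γ
  raw : List Bool
  output : List Bool

/-- One step of a stack program. -/
def stackStep {K Γ S : Type} [DecidableEq K] (prog : S → StackInstr K Γ S) (p : List Bool)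
    (c : StackCfg K Γ S) : Option (StackCfg K Γ S) :=
  match prog c.state with
  | .push k a t => some ⟨t, c.pos, Function.update c.stk k (a :: c.stk k), c.raw, c.output⟩
  | .read k d f => some ⟨f (c.stk k).head?, c.pos,
      if d then Function.update c.stk k (c.stk k).tail else c.stk, c.raw, c.output⟩
  | .scan f => some ⟨f (SDMachine.scanned p (c.pos + 1)), c.pos + 1, c.stk, c.raw, c.output⟩
  | .out b t => some ⟨t, c.pos, c.stk, c.raw, c.output ++ [b]⟩
  | .nop t => some ⟨t, c.pos, c.stk, c.raw, c.output⟩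
  | .fetch f => some ⟨f c.raw.getLast?, c.pos, c.stk, c.raw.dropLast, c.output⟩
  | .halt => none

/-- The states of the machine simulating a stack program with states `S`; counters are bounded
by `N`. -/
inductive StackMicro (K Γ S : Type) (N : ℕ) : Type where
  | first : S → StackMicro K Γ S N
  | second : S → StackMicro K Γ S N
  | ctl : S → StackMicro K Γ S N
  | pushMove : Fin (N + 1) → S → StackMicro K Γ S N
  | pushWrite : Fin (N + 1) → S → StackMicro K Γ S N
  | find : Fin (N + 1) → K → Bool → (Option Γ → S) → StackMicro K Γ S N
  | delMove : Fin (N + 1) → S → StackMicro K Γ S N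
  | delWrite : Fin (N + 1) → S → StackMicro K Γ S N
  | ret : S → StackMicro K Γ S N
  | scanned : (Option Bool → S) → StackMicro K Γ S N
  | overStacks : (Option Bool → S) → StackMicro K Γ S N
  | overRaw : (Option Bool → S) → StackMicro K Γ S N
  | take : (Option Bool → S) → StackMicro K Γ S N
  | back : S → StackMicro K Γ S N
  | backMove : S → StackMicro K Γ S N

instance {K Γ S : Type} {N : ℕ} [Finite K] [Finite Γ] [Finite S] : Finite (StackMicro K Γ S N) := by
  let F : ((Fin 6 × S) ⊕ (Fin 4 × Fin (N + 1) × S)) ⊕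
      ((Fin (N + 1) × K × Bool × (Option Γ → S)) ⊕ (Fin 4 × (Option Bool → S))) →
      StackMicro K Γ S N := fun x => match x with
    | .inl (.inl (0, s)) => .first s
    | .inl (.inl (1, s)) => .second s
    | .inl (.inl (2, s)) => .ctl s
    | .inl (.inl (3, s)) => .ret s
    | .inl (.inl (4, s)) => .back s
    | .inl (.inl (5, s)) => .backMove s
    | .inl (.inr (0, n, s)) => .pushMove n s
    | .inl (.inr (1, n, s)) => .pushWrite n s
    | .inl (.inr (2, n, s)) => .delMove n s
    | .inl (.inr (3, n, s)) => .delWrite n s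
    | .inr (.inl (n, k, d, f)) => .find n k d f
    | .inr (.inr (0, f)) => .scanned f
    | .inr (.inr (1, f)) => .overStacks f
    | .inr (.inr (2, f)) => .overRaw f
    | .inr (.inr (3, f)) => .take f
  refine Finite.of_surjective F fun q => ?_
  cases q with
  | first s => exact ⟨.inl (.inl (0, s)), rfl⟩
  | second s => exact ⟨.inl (.inl (1, s)), rfl⟩
  | ctl s => exact ⟨.inl (.inl (2, s)), rfl⟩
  | ret s => exact ⟨.inl (.inl (3, s)), rfl⟩
  | back s => exact ⟨.inl (.inl (4, s)), rfl⟩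
  | backMove s => exact ⟨.inl (.inl (5, s)), rfl⟩
  | pushMove n s => exact ⟨.inl (.inr (0, n, s)), rfl⟩
  | pushWrite n s => exact ⟨.inl (.inr (1, n, s)), rfl⟩
  | delMove n s => exact ⟨.inl (.inr (2, n, s)), rfl⟩
  | delWrite n s => exact ⟨.inl (.inr (3, n, s)), rfl⟩
  | find n k d f => exact ⟨.inr (.inl (n, k, d, f)), rfl⟩
  | scanned f => exact ⟨.inr (.inr (0, f)), rfl⟩
  | overStacks f => exact ⟨.inr (.inr (1, f)), rfl⟩
  | overRaw f => exact ⟨.inr (.inr (2, f)), rfl⟩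
  | take f => exact ⟨.inr (.inr (3, f)), rfl⟩

/-! ### Several stacks interleaved on one work tape -/

section Compile

variable {K Γ S : Type} [DecidableEq K] [Finite K] [Finite Γ] [Finite S]

/-- The code of a tagged stack symbol; `none` stands for a deleted one. -/
noncomputable def symCode (o : Option (K × Γ)) : ℕ :=
  o.elim 0 fun a => (Finite.equivFin (K × Γ) a : ℕ) + 1

variable (K Γ) in
/-- The largest symbol code. -/
noncomputable def maxCode : ℕ := Nat.card (K × Γ)

omit [DecidableEq K] in
theorem symCode_injective : Function.Injective (symCode : Option (K × Γ) → ℕ) := by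
  rintro (_ | a) (_ | b) h
  · rfl
  · simp [symCode] at h
  · simp [symCode] at h
  · simpa [symCode, Fin.val_inj] using h

omit [DecidableEq K] in
theorem symCode_le (o : Option (K × Γ)) : symCode o ≤ maxCode K Γ := by
  cases o with
  | none => simp [symCode]
  | some a => exact (Finite.equivFin (K × Γ) a).2

/-- The inverse of `symCode`. -/
noncomputable def symDecode : ℕ → Option (K × Γ) := Function.invFun symCode

omit [DecidableEq K] in
theorem symDecode_symCode (o : Option (K × Γ)) : symDecode (symCode o) = o :=
  Function.leftInverse_invFun symCode_injective o

/-- Transition rules of the machine simulating a stack program. -/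
noncomputable def stackRule (prog : S → StackInstr K Γ S) :
    StackMicro K Γ S (maxCode K Γ) → Option Bool → Option Bool →
      Option (SDAction × StackMicro K Γ S (maxCode K Γ))
  | .first s, _, _ => some (.move .left, .second s)
  | .second s, _, _ => some (.move .left, .ctl s)
  | .ctl s, _, _ => match prog s with
    | .push k a t =>
        some (.write (some false), .pushMove (Fin.ofNat _ (symCode (some (k, a)))) t)
    | .read k d f => some (.move .right, .find (Fin.ofNat _ 0) k d f)
    | .scan f => some (.scan, .scanned f)
    | .out b t => some (.out b, .ctl t)
    -- In a `ctl` state the head rests on the blank in front of the stack cells, so writing a blank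
    -- changes nothing.
    | .nop t => some (.write none, .ctl t)
    | .fetch f => some (.move .right, .overStacks f)
    | .halt => none
  | .pushMove n t, _, _ =>
      some (.move .left, if (n : ℕ) = 0 then .ctl t else .pushWrite n t)
  | .pushWrite n t, _, _ => some (.write (some true), .pushMove (Fin.ofNat _ ((n : ℕ) - 1)) t)
  | .find _ _ _ f, _, none => some (.move .left, .ret (f none))
  | .find c k d f, _, some true => some (.move .right, .find (Fin.ofNat _ ((c : ℕ) + 1)) k d f)
  | .find c k d f, _, some false => match (symDecode (c : ℕ) : Option (K × Γ)) with
    | none => some (.move .right, .find (Fin.ofNat _ 0) k d f)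
    | some (k', a) =>
      if k' = k then
        -- This write leaves the cell unchanged; the deletion itself happens on the way back.
        if d then some (.write (some false), .delMove c (f (some a)))
        else some (.move .left, .ret (f (some a)))
      else some (.move .right, .find (Fin.ofNat _ 0) k d f)
  | .delMove n t, _, _ => some (.move .left, if (n : ℕ) = 0 then .ret t else .delWrite n t)
  | .delWrite n t, _, _ => some (.write (some false), .delMove (Fin.ofNat _ ((n : ℕ) - 1)) t)
  | .ret t, _, none => some (.write none, .ctl t)
  | .ret t, _, some _ => some (.move .left, .ret t)
  -- A newly scanned program symbol becomes visible to the control only in the step after the scan.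
  | .scanned f, s, _ => some (.write none, .ctl (f s))
  | .overStacks f, _, some _ => some (.move .right, .overStacks f)
  | .overStacks f, _, none => some (.move .right, .overRaw f)
  | .overRaw f, _, some _ => some (.move .right, .overRaw f)
  | .overRaw f, _, none => some (.move .left, .take f)
  | .take f, _, none => some (.move .left, .ret (f none))
  | .take f, _, some b => some (.write none, .backMove (f (some b)))
  | .backMove t, _, _ => some (.move .left, .back t)
  | .back t, _, some _ => some (.move .left, .back t)
  | .back t, _, none => some (.move .left, .ret t)

/-- The machine simulating a stack program. -/
noncomputable def stackMachine (prog : S → StackInstr K Γ S) (s₀ : S) : SDMachine where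
  Q := StackMicro K Γ S (maxCode K Γ)
  finite_Q := inferInstance
  start := .first s₀
  rule := stackRule prog

/-- The bits storing a sequence of tagged stack symbols. -/
noncomputable def symBits (ws : List (Option (K × Γ))) : List Bool :=
  ws.flatMap fun o => List.replicate (symCode o) true ++ [false]

/-- The content of the stack `k`. -/
def stackOf (ws : List (Option (K × Γ))) (k : K) : List Γ :=
  ws.filterMap fun o => o.bind fun a => if a.1 = k then some a.2 else none

variable (prog : S → StackInstr K Γ S) (s₀ : S) (p : List Bool)

/-- The configurations of the simulating machine. -/
def microCfg (q : StackMicro K Γ S (maxCode K Γ)) (n : ℕ) (l r : List (Option Bool))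
    (o : List Bool) : (stackMachine prog s₀).Cfg :=
  ⟨q, n, listTape l r, o⟩

variable {prog s₀ p}

theorem reaches_trans {σ : Type*} {f : σ → Option σ} {a b c : σ} (h : Reaches f a b)
    (h' : Reaches f b c) : Reaches f a c :=
  Relation.ReflTransGen.trans h h'

theorem micro_head {q q' : StackMicro K Γ S (maxCode K Γ)} {a : SDAction} {n : ℕ}
    {l r : List (Option Bool)} {o : List Bool} {c}
    (h : stackRule prog q (SDMachine.scanned p n) (listTape l r).head = some (a, q'))
    (hr : Reaches ((stackMachine prog s₀).step p)
      ((stackMachine prog s₀).act (microCfg prog s₀ q n l r o) a q') c) :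
    Reaches ((stackMachine prog s₀).step p) (microCfg prog s₀ q n l r o) c := by
  refine Relation.ReflTransGen.head ?_ hr
  have h' : (stackMachine prog s₀).rule q (SDMachine.scanned p n) (listTape l r).head
    = some (a, q') := h
  simp only [SDMachine.step, microCfg, h']
  rfl

theorem micro_right {q q' : StackMicro K Γ S (maxCode K Γ)} {n : ℕ}
    {l r : List (Option Bool)} {o : List Bool} {b : Option Bool} {c}
    (h : stackRule prog q (SDMachine.scanned p n) b = some (.move .right, q'))
    (hr : Reaches ((stackMachine prog s₀).step p) (microCfg prog s₀ q' n (b :: l) r o) c) :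
    Reaches ((stackMachine prog s₀).step p) (microCfg prog s₀ q n l (b :: r) o) c := by
  refine micro_head (by simpa using h) ?_
  simpa [SDMachine.act, microCfg] using hr

theorem micro_left {q q' : StackMicro K Γ S (maxCode K Γ)} {n : ℕ}
    {l r : List (Option Bool)} {o : List Bool} {a b : Option Bool} {c}
    (h : stackRule prog q (SDMachine.scanned p n) b = some (.move .left, q'))
    (hr : Reaches ((stackMachine prog s₀).step p) (microCfg prog s₀ q' n l (a :: b :: r) o) c) :
    Reaches ((stackMachine prog s₀).step p) (microCfg prog s₀ q n (a :: l) (b :: r) o) c := by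
  refine micro_head (by simpa using h) ?_
  simpa [SDMachine.act, microCfg] using hr

theorem micro_left_nil {q q' : StackMicro K Γ S (maxCode K Γ)} {n : ℕ}
    {r : List (Option Bool)} {o : List Bool} {b : Option Bool} {c}
    (h : stackRule prog q (SDMachine.scanned p n) b = some (.move .left, q'))
    (hr : Reaches ((stackMachine prog s₀).step p) (microCfg prog s₀ q' n [] (none :: b :: r) o) c) :
    Reaches ((stackMachine prog s₀).step p) (microCfg prog s₀ q n [] (b :: r) o) c := by
  refine micro_head (by simpa using h) ?_
  simpa [SDMachine.act, microCfg] using hr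

theorem micro_write {q q' : StackMicro K Γ S (maxCode K Γ)} {n : ℕ}
    {l r : List (Option Bool)} {o : List Bool} {b b' : Option Bool} {c}
    (h : stackRule prog q (SDMachine.scanned p n) b = some (.write b', q'))
    (hr : Reaches ((stackMachine prog s₀).step p) (microCfg prog s₀ q' n l (b' :: r) o) c) :
    Reaches ((stackMachine prog s₀).step p) (microCfg prog s₀ q n l (b :: r) o) c := by
  refine micro_head (by simpa using h) ?_
  simpa [SDMachine.act, microCfg] using hr

omit [DecidableEq K] [Finite K] [Finite Γ] in
theorem val_ofNat_code {c : ℕ} (h : c ≤ maxCode K Γ) :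
    ((Fin.ofNat (maxCode K Γ + 1) c : Fin _) : ℕ) = c := by
  simp [Fin.ofNat, Nat.mod_eq_of_lt (Nat.lt_succ_of_le h)]

/-- Leaving to the left, the head returns to the blank in front of the stack cells. -/
theorem reaches_leave {q : StackMicro K Γ S (maxCode K Γ)} (t : S) (n : ℕ) (o : List Bool)
    (m : List Bool) (b : Option Bool) (r : List (Option Bool))
    (h : stackRule prog q (SDMachine.scanned p n) b = some (.move .left, .ret t)) :
    Reaches ((stackMachine prog s₀).step p)
      (microCfg prog s₀ q n (m.map some ++ [none]) (b :: r) o)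
      (microCfg prog s₀ (.ctl t) n [] (none :: (m.reverse.map some ++ b :: r)) o) := by
  induction m generalizing b r q with
  | nil =>
    refine micro_left h ?_
    refine micro_write rfl ?_
    exact Relation.ReflTransGen.refl
  | cons a m ih =>
    refine micro_left h ?_
    simpa using ih (some a) (b :: r) rfl

/-- A symbol is coded in unary by `c` ones and a zero. Turning the ones into zeros leaves `c + 1`
codes of deleted symbols, so nothing has to be shifted. -/
theorem reaches_delMove (t : S) (n : ℕ) (o : List Bool) (c : ℕ) (hc : c ≤ maxCode K Γ)
    (m : List Bool) (r : List (Option Bool)) :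
    Reaches ((stackMachine prog s₀).step p)
      (microCfg prog s₀ (.delMove (Fin.ofNat _ c) t) n
        ((List.replicate c true ++ m).map some ++ [none]) (some false :: r) o)
      (microCfg prog s₀ (.ctl t) n []
        (none :: ((m.reverse ++ List.replicate (c + 1) false).map some ++ r)) o) := by
  induction c generalizing r with
  | zero =>
    have := reaches_leave (prog := prog) (s₀ := s₀) (p := p)
      (q := .delMove (Fin.ofNat _ 0) t) t n o m (some false) r
      (by simp [stackRule])
    simpa using this
  | succ c ih =>
    have e : stackRule prog (.delMove (Fin.ofNat _ (c + 1)) t) (SDMachine.scanned p n) (some false)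
        = some (.move .left, .delWrite (Fin.ofNat _ (c + 1)) t) := by
      simp only [stackRule, val_ofNat_code hc]; simp
    rw [List.replicate_succ, List.cons_append, List.map_cons, List.cons_append]
    refine micro_left e ?_
    have e' : stackRule prog (.delWrite (Fin.ofNat _ (c + 1)) t) (SDMachine.scanned p n) (some true)
        = some (.write (some false), .delMove (Fin.ofNat _ c) t) := by
      simp only [stackRule, val_ofNat_code hc]; simp
    refine micro_write e' ?_
    have := ih (by omega) (some false :: r)
    convert! this using 3
    simp [List.replicate_succ']

theorem reaches_find_count (k : K) (d : Bool) (f : Option Γ → S) (n : ℕ) (o : List Bool)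
    (c j : ℕ) (hc : c + j ≤ maxCode K Γ) (l r : List (Option Bool)) :
    Reaches ((stackMachine prog s₀).step p)
      (microCfg prog s₀ (.find (Fin.ofNat _ c) k d f) n l
        (List.replicate j (some true) ++ r) o)
      (microCfg prog s₀ (.find (Fin.ofNat _ (c + j)) k d f) n
        (List.replicate j (some true) ++ l) r o) := by
  induction j generalizing c l with
  | zero => exact Relation.ReflTransGen.refl
  | succ j ih =>
    rw [List.replicate_succ, List.cons_append]
    have e : stackRule prog (.find (Fin.ofNat _ c) k d f) (SDMachine.scanned p n) (some true)
        = some (.move .right, .find (Fin.ofNat _ (c + 1)) k d f) := by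
      simp only [stackRule, val_ofNat_code (show c ≤ maxCode K Γ by omega)]
    refine micro_right e ?_
    have := ih (c + 1) (by omega) (some true :: l)
    rw [show c + (j + 1) = c + 1 + j by omega]
    rwa [show some true :: List.replicate j (some true) ++ l =
        List.replicate j (some true) ++ some true :: l by
      rw [← List.replicate_succ, List.replicate_succ', List.append_assoc]; rfl]

omit [Finite K] [Finite Γ] in
theorem stackOf_cons (o : Option (K × Γ)) (ws : List (Option (K × Γ))) (k : K) :
    stackOf (o :: ws) k = stackOf [o] k ++ stackOf ws k := by
  simp [stackOf, List.filterMap_cons]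
  split <;> simp

omit [Finite K] [Finite Γ] in
theorem stackOf_append (ws ws' : List (Option (K × Γ))) (k : K) :
    stackOf (ws ++ ws') k = stackOf ws k ++ stackOf ws' k := by
  simp [stackOf]

omit [Finite K] [Finite Γ] in
theorem stackOf_replicate_none (n : ℕ) (k : K) :
    stackOf (List.replicate n (none : Option (K × Γ))) k = [] := by
  simp [stackOf]

omit [Finite K] [Finite Γ] in
theorem stackOf_singleton (k' : K) (a : Γ) (k : K) :
    stackOf [some (k', a)] k = if k' = k then [a] else [] := by
  by_cases h : k' = k <;> simp [stackOf, h]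

omit [DecidableEq K] in
theorem symBits_cons (o : Option (K × Γ)) (ws : List (Option (K × Γ))) :
    symBits (o :: ws) = List.replicate (symCode o) true ++ false :: symBits ws := by
  simp [symBits]

omit [DecidableEq K] in
theorem symBits_replicate_none_append (n : ℕ) (ws : List (Option (K × Γ))) :
    symBits (List.replicate n none ++ ws) = List.replicate n false ++ symBits ws := by
  induction n with
  | zero => rfl
  | succ n ih =>
    rw [List.replicate_succ, List.cons_append, symBits_cons, ih]
    simp [symCode, List.replicate_succ]

/-- Since pushes happen at the left end, the first symbol tagged `k` from the left is the top of
stack `k`. Deleted symbols and those of other stacks are passed over; the separating blank signals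
an empty stack. -/
theorem reaches_find (k : K) (d : Bool) (f : Option Γ → S) (n : ℕ) (o : List Bool)
    (ws : List (Option (K × Γ))) (m : List Bool) (r : List (Option Bool)) :
    ∃ ws' : List (Option (K × Γ)),
      (∀ k', stackOf ws' k' =
        if d = true ∧ k' = k then (stackOf ws k').tail else stackOf ws k') ∧
      Reaches ((stackMachine prog s₀).step p)
        (microCfg prog s₀ (.find (Fin.ofNat _ 0) k d f) n (m.map some ++ [none])
          ((symBits ws).map some ++ none :: r) o)
        (microCfg prog s₀ (.ctl (f (stackOf ws k).head?)) n []
          (none :: ((m.reverse ++ symBits ws').map some ++ none :: r)) o) := by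
  induction ws generalizing m with
  | nil =>
    refine ⟨[], by simp [stackOf], ?_⟩
    have := reaches_leave (prog := prog) (s₀ := s₀) (p := p)
      (q := .find (Fin.ofNat _ 0) k d f) (f none) n o m none r rfl
    simpa [symBits, stackOf] using this
  | cons a ws ih =>
    have h₁ := reaches_find_count (prog := prog) (s₀ := s₀) (p := p) k d f n o 0 (symCode a)
      (by simpa using symCode_le a) (m.map some ++ [none])
      (some false :: ((symBits ws).map some ++ none :: r))
    -- Deleted symbols and foreign tags are treated together: neither contributes to stack `k`.
    have hskip : stackOf [a] k = [] →
        stackRule prog (.find (Fin.ofNat _ (symCode a)) k d f) (SDMachine.scanned p n) (some false)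
          = some (.move .right, .find (Fin.ofNat _ 0) k d f) →
        ∃ ws' : List (Option (K × Γ)),
          (∀ k', stackOf ws' k' = if d = true ∧ k' = k then (stackOf (a :: ws) k').tail
            else stackOf (a :: ws) k') ∧
          Reaches ((stackMachine prog s₀).step p)
            (microCfg prog s₀ (.find (Fin.ofNat _ 0) k d f) n (m.map some ++ [none])
              ((symBits (a :: ws)).map some ++ none :: r) o)
            (microCfg prog s₀ (.ctl (f (stackOf (a :: ws) k).head?)) n []
              (none :: ((m.reverse ++ symBits ws').map some ++ none :: r)) o) := by
      intro ha hrule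
      obtain ⟨ws', hw, hr⟩ := ih (false :: (List.replicate (symCode a) true ++ m))
      refine ⟨a :: ws', fun k' => ?_, ?_⟩
      · rw [stackOf_cons, hw, stackOf_cons a ws]
        split_ifs with hk
        · rw [hk.2, ha]; rfl
        · rfl
      · rw [stackOf_cons, ha, List.nil_append]
        refine reaches_trans (by simpa [symBits_cons] using h₁) ?_
        refine micro_right hrule ?_
        simpa [symBits_cons] using hr
    have hdec : (symDecode ((Fin.ofNat (maxCode K Γ + 1) (symCode a) : Fin _) : ℕ) :
        Option (K × Γ)) = a := by
      rw [val_ofNat_code (symCode_le a), symDecode_symCode]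
    rcases a with _ | ⟨k', a⟩
    · exact hskip (by simp [stackOf]) (by simp only [stackRule, hdec])
    · by_cases hk : k' = k
      · subst hk
        cases d with
        | false =>
          refine ⟨some (k', a) :: ws, by simp, ?_⟩
          refine reaches_trans (by simpa [symBits_cons] using h₁) ?_
          rw [stackOf_cons, stackOf_singleton]
          have := reaches_leave (prog := prog) (s₀ := s₀) (p := p)
            (q := .find (Fin.ofNat _ (symCode (some (k', a)))) k' false f) (f (some a)) n o
            (List.replicate (symCode (some (k', a))) true ++ m) (some false)
            ((symBits ws).map some ++ none :: r) (by simp only [stackRule, hdec]; simp)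
          simpa [symBits_cons] using this
        | true =>
          refine ⟨List.replicate (symCode (some (k', a)) + 1) none ++ ws, fun k => ?_, ?_⟩
          · rw [stackOf_append, stackOf_replicate_none, stackOf_cons, stackOf_singleton]
            by_cases hk : k = k'
            · simp [hk]
            · simp [hk, Ne.symm hk]
          · have hrule : stackRule prog (.find (Fin.ofNat _ (symCode (some (k', a)))) k' true f)
                (SDMachine.scanned p n) (some false) = some (.write (some false),
                  .delMove (Fin.ofNat _ (symCode (some (k', a)))) (f (some a))) := by
              simp only [stackRule, hdec]; simp
            refine reaches_trans (by simpa [symBits_cons] using h₁) ?_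
            refine micro_write (b' := some false)
              (q' := .delMove (Fin.ofNat _ (symCode (some (k', a)))) (f (some a)))
              hrule ?_
            have := reaches_delMove (prog := prog) (s₀ := s₀) (p := p) (f (some a)) n o
              (symCode (some (k', a))) (symCode_le _) m ((symBits ws).map some ++ none :: r)
            rw [stackOf_cons, stackOf_singleton, symBits_replicate_none_append]
            simpa using this
      · exact hskip (by simp [stackOf_singleton, hk]) (by simp only [stackRule, hdec, if_neg hk])

/-- The stacks grow to the left into blank tape, so the auxiliary string to their right is never
disturbed. -/
theorem reaches_pushMove (t : S) (n : ℕ) (o : List Bool) (c : ℕ) (hc : c ≤ maxCode K Γ)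
    (b : Option Bool) (r : List (Option Bool)) :
    Reaches ((stackMachine prog s₀).step p)
      (microCfg prog s₀ (.pushMove (Fin.ofNat _ c) t) n [] (b :: r) o)
      (microCfg prog s₀ (.ctl t) n [] (none :: (List.replicate c (some true) ++ b :: r)) o) := by
  induction c generalizing b r with
  | zero =>
    refine micro_left_nil (q' := .ctl t) (by simp [stackRule]) ?_
    exact Relation.ReflTransGen.refl
  | succ c ih =>
    have e : stackRule prog (.pushMove (Fin.ofNat _ (c + 1)) t) (SDMachine.scanned p n) b
        = some (.move .left, .pushWrite (Fin.ofNat _ (c + 1)) t) := by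
      simp only [stackRule, val_ofNat_code hc]; simp
    have e' : stackRule prog (.pushWrite (Fin.ofNat _ (c + 1)) t) (SDMachine.scanned p n) none
        = some (.write (some true), .pushMove (Fin.ofNat _ c) t) := by
      simp only [stackRule, val_ofNat_code hc]; simp
    refine micro_left_nil e (micro_write e' ?_)
    rw [List.replicate_succ', List.append_assoc]
    exact ih (by omega) (some true) (b :: r)

theorem reaches_right {q : StackMicro K Γ S (maxCode K Γ)} (n : ℕ) (o : List Bool)
    (h : ∀ b : Bool, stackRule prog q (SDMachine.scanned p n) (some b) = some (.move .right, q))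
    (m : List Bool) (l r : List (Option Bool)) :
    Reaches ((stackMachine prog s₀).step p)
      (microCfg prog s₀ q n l (m.map some ++ r) o)
      (microCfg prog s₀ q n (m.reverse.map some ++ l) r o) := by
  induction m generalizing l with
  | nil => exact Relation.ReflTransGen.refl
  | cons b m ih =>
    refine micro_right (h b) ?_
    simpa using ih (some b :: l)

theorem reaches_back {q : StackMicro K Γ S (maxCode K Γ)} (t : S) (n : ℕ) (o : List Bool)
    (m : List Bool) (b : Option Bool) (l r : List (Option Bool))
    (h : stackRule prog q (SDMachine.scanned p n) b = some (.move .left, .back t)) :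
    Reaches ((stackMachine prog s₀).step p)
      (microCfg prog s₀ q n (m.map some ++ none :: l) (b :: r) o)
      (microCfg prog s₀ (.back t) n l (none :: (m.reverse.map some ++ b :: r)) o) := by
  induction m generalizing b r q with
  | nil =>
    refine micro_left h ?_
    exact Relation.ReflTransGen.refl
  | cons a m ih =>
    refine micro_left h ?_
    simpa using ih (some a) (b :: r) rfl

theorem microCfg_concat_none (q : StackMicro K Γ S (maxCode K Γ)) (n : ℕ)
    (l r : List (Option Bool)) (o : List Bool) :
    microCfg prog s₀ q n l (r ++ [none]) o = microCfg prog s₀ q n l r o := by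
  simp only [microCfg, listTape.concat_none]

/-- The reserve is consumed from its right end because erasing the last bit just extends the blank
region; the separator stays in place. -/
theorem reaches_fetch (f : Option Bool → S) (n : ℕ) (o : List Bool) (m raw : List Bool) :
    Reaches ((stackMachine prog s₀).step p)
      (microCfg prog s₀ (.overStacks f) n [none] (m.map some ++ none :: raw.map some) o)
      (microCfg prog s₀ (.ctl (f raw.getLast?)) n []
        (none :: (m.map some ++ none :: raw.dropLast.map some)) o) := by
  refine reaches_trans (reaches_right n o (fun b => rfl) m _ _) ?_
  refine micro_right (q' := .overRaw f) rfl ?_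
  have h := reaches_right (prog := prog) (s₀ := s₀) (p := p) (q := .overRaw f) n o
    (fun b => rfl) raw (none :: (m.reverse.map some ++ [none])) []
  rw [List.append_nil] at h
  refine reaches_trans h ?_
  -- The blank after the reserve is made explicit, so that the head can turn round on it.
  rw [← microCfg_concat_none, List.nil_append]
  rcases List.eq_nil_or_concat raw with rfl | ⟨raw', b, rfl⟩
  · refine micro_left (q' := .take f) rfl ?_
    have := reaches_leave (prog := prog) (s₀ := s₀) (p := p) (q := .take f) (f none) n o
      m.reverse none [none] rfl
    rw [← microCfg_concat_none (r := none :: (m.map some ++ _))]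
    simpa using this
  · simp only [List.concat_eq_append, List.reverse_append, List.reverse_singleton,
      List.map_cons, List.cons_append]
    refine micro_left (q' := .take f) rfl ?_
    refine micro_write (q' := .backMove (f (some b))) (b' := none) rfl ?_
    refine reaches_trans (reaches_back (f (some b)) n o raw'.reverse none _ [none] rfl) ?_
    have := reaches_leave (prog := prog) (s₀ := s₀) (p := p) (q := .back (f (some b)))
      (f (some b)) n o m.reverse none
      (raw'.reverse.reverse.map some ++ none :: [none]) rfl
    refine reaches_trans this ?_
    rw [← microCfg_concat_none (r := none :: (m.map some ++ _)),
      ← microCfg_concat_none (r := none :: (m.map some ++ _) ++ [none])]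
    simp only [List.reverse_reverse, List.getLast?_concat, List.dropLast_concat, List.cons_append,
      List.append_assoc, List.nil_append]
    exact Relation.ReflTransGen.refl

/-- The configuration `c'` of the simulating machine represents the configuration `c` of the stack
program. -/
def StackRepr (prog : S → StackInstr K Γ S) (s₀ : S) (c : StackCfg K Γ S)
    (c' : (stackMachine prog s₀).Cfg) : Prop :=
  ∃ ws : List (Option (K × Γ)), (∀ k, stackOf ws k = c.stk k) ∧
    c' = microCfg prog s₀ (.ctl c.state) c.pos []
      (none :: ((symBits ws).map some ++ none :: c.raw.map some)) c.output

theorem StackRepr.step {c d : StackCfg K Γ S} {c' : (stackMachine prog s₀).Cfg}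
    (h : StackRepr prog s₀ c c') (hd : stackStep prog p c = some d) :
    ∃ d', StackRepr prog s₀ d d' ∧ Reaches ((stackMachine prog s₀).step p) c' d' := by
  obtain ⟨ws, hw, rfl⟩ := h
  obtain ⟨s, n, stk, raw, o⟩ := c
  simp only [stackStep] at hd hw ⊢
  have hctl : ∀ x b, stackRule prog (.ctl s) x b = match prog s with
    | .push k a t =>
        some (.write (some false), .pushMove (Fin.ofNat _ (symCode (some (k, a)))) t)
    | .read k d f => some (.move .right, .find (Fin.ofNat _ 0) k d f)
    | .scan f => some (.scan, .scanned f)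
    | .out b t => some (.out b, .ctl t)
    | .nop t => some (.write none, .ctl t)
    | .fetch f => some (.move .right, .overStacks f)
    | .halt => none := fun _ _ => rfl
  split at hd <;> rename_i e <;> simp only [e] at hctl <;> cases hd
  · rename_i k a t
    refine ⟨_, ⟨some (k, a) :: ws, fun k' => ?_, rfl⟩, ?_⟩
    · rw [stackOf_cons, stackOf_singleton]
      by_cases hk : k = k'
      · subst hk; simp [hw]
      · simp [hk, Ne.symm hk, hw]
    · refine micro_write (hctl _ _) ?_
      have := reaches_pushMove (prog := prog) (s₀ := s₀) (p := p) t n o (symCode (some (k, a)))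
        (symCode_le _) (some false) ((symBits ws).map some ++ none :: raw.map some)
      simpa [symBits_cons] using this
  · rename_i k d f
    obtain ⟨ws', hw', hr⟩ := reaches_find (prog := prog) (s₀ := s₀) (p := p) k d f n o ws []
      (raw.map some)
    refine ⟨_, ⟨ws', fun k' => ?_, rfl⟩, ?_⟩
    · rw [hw']
      by_cases hd : d = true <;> by_cases hk : k' = k <;> simp [hd, hk, hw]
    · refine micro_right (hctl _ _) ?_
      simpa [hw] using hr
  · rename_i f
    refine ⟨_, ⟨ws, hw, rfl⟩, ?_⟩
    refine micro_head (hctl _ _) ?_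
    exact micro_write (q := .scanned f) (n := n + 1) rfl Relation.ReflTransGen.refl
  · refine ⟨_, ⟨ws, hw, rfl⟩, ?_⟩
    exact micro_head (hctl _ _) Relation.ReflTransGen.refl
  · refine ⟨_, ⟨ws, hw, rfl⟩, ?_⟩
    exact micro_write (hctl _ _) Relation.ReflTransGen.refl
  · rename_i f
    refine ⟨_, ⟨ws, hw, rfl⟩, ?_⟩
    exact micro_right (hctl _ _) (reaches_fetch f n o (symBits ws) raw)

theorem StackRepr.reaches {c d : StackCfg K Γ S} {c' : (stackMachine prog s₀).Cfg}
    (h : StackRepr prog s₀ c c') (hd : Reaches (stackStep prog p) c d) :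
    ∃ d', StackRepr prog s₀ d d' ∧ Reaches ((stackMachine prog s₀).step p) c' d' := by
  induction hd with
  | refl => exact ⟨c', h, Relation.ReflTransGen.refl⟩
  | tail _ hs ih =>
    obtain ⟨d', h', hr⟩ := ih
    obtain ⟨e', h'', hr'⟩ := h'.step hs
    exact ⟨e', h'', reaches_trans hr hr'⟩

/-- The machine simulating a stack program has the output of the program. -/
theorem mem_run_stackMachine {y : List Bool} {c : StackCfg K Γ S}
    (h : Reaches (stackStep prog p) ⟨s₀, 0, fun _ => [], y, []⟩ c)
    (hc : prog c.state = .halt) (hp : c.pos = p.length) :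
    c.output ∈ (stackMachine prog s₀).run p y := by
  have h₀ : StackRepr prog s₀ ⟨s₀, 0, fun _ => [], y, []⟩
      (microCfg prog s₀ (.ctl s₀) 0 [] (none :: none :: y.map some) []) :=
    ⟨[], fun k => rfl, rfl⟩
  have hi : Reaches ((stackMachine prog s₀).step p) ((stackMachine prog s₀).init y)
      (microCfg prog s₀ (.ctl s₀) 0 [] (none :: none :: y.map some) []) := by
    have : (stackMachine prog s₀).init y = microCfg prog s₀ (.first s₀) 0 [] (y.map some) [] := rfl
    rw [this]
    cases y with
    | nil =>
      rw [List.map_nil, ← microCfg_concat_none, ← microCfg_concat_none (r := [none, none])]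
      refine micro_left_nil (q' := .second s₀) rfl ?_
      exact micro_left_nil (q' := .ctl s₀) rfl Relation.ReflTransGen.refl
    | cons b y =>
      refine micro_left_nil (q' := .second s₀) rfl ?_
      exact micro_left_nil (q' := .ctl s₀) rfl Relation.ReflTransGen.refl
  obtain ⟨c', ⟨ws, hw, rfl⟩, hr⟩ := h₀.reaches h
  simp only [SDMachine.run, Part.mem_bind_iff, Part.mem_assert_iff, Part.mem_some_iff, mem_eval]
  refine ⟨_, ⟨reaches_trans hi hr, ?_⟩, hp, rfl⟩
  have : (stackMachine prog s₀).rule (.ctl c.state) = fun _ _ => none := by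
    funext x b
    simp [stackMachine, stackRule, hc]
  simp [SDMachine.step, microCfg, this]

end Compile

/-! ### Self-delimiting machines from partial recursive functions -/

/-- The number whose binary digits, the least significant one first, are those of `l` followed
by a `1`. -/
def bitsCode (l : List Bool) : ℕ := l.foldr (fun b n => 2 * n + b.toNat) 1

@[simp] theorem bitsCode_nil : bitsCode [] = 1 := rfl

@[simp] theorem bitsCode_cons (b : Bool) (l : List Bool) :
    bitsCode (b :: l) = 2 * bitsCode l + b.toNat := rfl

theorem bitsCode_pos (l : List Bool) : 0 < bitsCode l := by
  induction l with
  | nil => simp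
  | cons b l ih => rw [bitsCode_cons]; omega

/-! ### Alternating evaluation of a code with scanning of program bits -/

namespace PartrecLoop

open PartrecToTM2 ToPartrec

/-- A bit as a stack symbol. -/
def bitSym : Bool → Γ'
  | false => Γ'.bit0
  | true => Γ'.bit1

/-- Mathlib's encoding puts the least significant digit on top of the stack, as `bitsCode` does.
Prepending a bit to a coded list is therefore a single push. -/
theorem trNat_bitsCode (l : List Bool) : trNat (bitsCode l) = l.map bitSym ++ [Γ'.bit1] := by
  have key : ∀ l : List Bool, ∃ n : PosNum, (n : ℕ) = bitsCode l ∧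
      trPosNum n = l.map bitSym ++ [Γ'.bit1] := by
    intro l
    induction l with
    | nil => exact ⟨PosNum.one, rfl, rfl⟩
    | cons b l ih =>
      obtain ⟨n, hn, ht⟩ := ih
      cases b with
      | false => exact ⟨n.bit0, by simp [hn, two_mul], by simp [trPosNum, ht, bitSym]⟩
      | true => exact ⟨n.bit1, by simp [hn, two_mul], by simp [trPosNum, ht, bitSym]⟩
  obtain ⟨n, hn, ht⟩ := key l
  rw [← hn, trNat, PosNum.of_to_nat, trNum, ht]

/-- The statements of `PartrecToTM2.tr`. -/
abbrev TrStmt : Type := TM2.Stmt (fun _ : K' => Γ') Λ' (Option Γ')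

/-- The configurations of `PartrecToTM2.tr`. -/
abbrev TrCfg : Type := TM2.Cfg (fun _ : K' => Γ') Λ' (Option Γ')

instance : Finite K' := by
  refine Finite.of_surjective (![K'.main, K'.rev, K'.aux, K'.stack] : Fin 4 → K') fun k => ?_
  cases k
  exacts [⟨0, rfl⟩, ⟨1, rfl⟩, ⟨2, rfl⟩, ⟨3, rfl⟩]

variable (c : Code)

/-- The statements occurring in the machine evaluating `c`, and `none`. -/
noncomputable def stmtSupp : Finset (Option TrStmt) := TM2.stmts tr (codeSupp c Cont'.halt)

/-- The statements of the machine evaluating `c`. -/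
abbrev Stm : Type := {q : Option TrStmt // q ∈ stmtSupp c}

instance : Finite (Stm c) := Finset.finite_toSet (stmtSupp c)

/-- A statement as an element of `Stm c`; statements that do not occur become `none`. -/
noncomputable def toStm (q : TrStmt) : Stm c :=
  open Classical in
  if h : some q ∈ stmtSupp c then ⟨some q, h⟩
  else ⟨none, Finset.none_mem_insertNone⟩

variable {c} in
theorem toStm_val {q : TrStmt} (h : some q ∈ stmtSupp c) :
    (toStm c q).1 = some q := by
  rw [toStm, dif_pos h]

/-- The states of the stack program which evaluates `c` again and again, reading a bit in between,
until the head of the result is not zero. -/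
inductive LoopState (c : Code) : Type where
  | markY : LoopState c
  | endY : LoopState c
  | load : LoopState c
  | loadBit : Bool → LoopState c
  | markP : LoopState c
  | endP : LoopState c
  | run : Stm c → Option Γ' → LoopState c
  | done : LoopState c
  | scan : LoopState c
  | pushBit : Bool → LoopState c
  | emit : Bool → LoopState c
  | emitThen : Bool → Bool → LoopState c
  | final : LoopState c

instance : Finite (LoopState c) := by
  let F : (Fin 8 ⊕ (Fin 3 × Bool)) ⊕ ((Stm c × Option Γ') ⊕ (Bool × Bool)) → LoopState c :=
    fun x => match x with
    | .inl (.inl 0) => .markY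
    | .inl (.inl 1) => .endY
    | .inl (.inl 2) => .load
    | .inl (.inl 3) => .markP
    | .inl (.inl 4) => .endP
    | .inl (.inl 5) => .done
    | .inl (.inl 6) => .scan
    | .inl (.inl 7) => .final
    | .inl (.inr (0, b)) => .loadBit b
    | .inl (.inr (1, b)) => .pushBit b
    | .inl (.inr (2, b)) => .emit b
    | .inr (.inl (q, v)) => .run q v
    | .inr (.inr (b, b')) => .emitThen b b'
  refine Finite.of_surjective F fun q => ?_
  cases q with
  | markY => exact ⟨.inl (.inl 0), rfl⟩
  | endY => exact ⟨.inl (.inl 1), rfl⟩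
  | load => exact ⟨.inl (.inl 2), rfl⟩
  | markP => exact ⟨.inl (.inl 3), rfl⟩
  | endP => exact ⟨.inl (.inl 4), rfl⟩
  | done => exact ⟨.inl (.inl 5), rfl⟩
  | scan => exact ⟨.inl (.inl 6), rfl⟩
  | final => exact ⟨.inl (.inl 7), rfl⟩
  | loadBit b => exact ⟨.inl (.inr (0, b)), rfl⟩
  | pushBit b => exact ⟨.inl (.inr (1, b)), rfl⟩
  | emit b => exact ⟨.inl (.inr (2, b)), rfl⟩
  | run q v => exact ⟨.inr (.inl (q, v)), rfl⟩
  | emitThen b b' => exact ⟨.inr (.inr (b, b')), rfl⟩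

/-- The state in which the evaluation of `c` starts. -/
noncomputable def enter : LoopState c :=
  .run (toStm c (tr (trNormal c Cont'.halt))) none

/-- The stack program evaluating `c` again and again. -/
noncomputable def loop : LoopState c → StackInstr K' Γ' (LoopState c)
  | .markY => .push K'.main Γ'.cons .endY
  | .endY => .push K'.main Γ'.bit1 .load
  | .load => .fetch fun o => o.elim .markP .loadBit
  | .loadBit b => .push K'.main (bitSym b) .load
  | .markP => .push K'.main Γ'.cons .endP
  | .endP => .push K'.main Γ'.bit1 (enter c)
  | .run ⟨none, _⟩ _ => .nop .done
  | .run ⟨some (TM2.Stmt.push k f q), _⟩ v => .push k (f v) (.run (toStm c q) v)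
  | .run ⟨some (TM2.Stmt.peek k f q), _⟩ v => .read k false fun o => .run (toStm c q) (f v o)
  | .run ⟨some (TM2.Stmt.pop k f q), _⟩ v => .read k true fun o => .run (toStm c q) (f v o)
  | .run ⟨some (TM2.Stmt.load a q), _⟩ v => .nop (.run (toStm c q) (a v))
  | .run ⟨some (TM2.Stmt.branch f q₁ q₂), _⟩ v => .nop (.run (toStm c (cond (f v) q₁ q₂)) v)
  | .run ⟨some (TM2.Stmt.goto l), _⟩ v => .nop (.run (toStm c (tr (l v))) v)
  | .run ⟨some TM2.Stmt.halt, _⟩ _ => .nop .done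
  | .done => .read K'.main true fun o => match o with
    | some Γ'.bit0 => .emit false
    | some Γ'.bit1 => .emit true
    | _ => .scan
  | .scan => .scan fun o => o.elim .final .pushBit
  | .pushBit b => .push K'.main (bitSym b) (enter c)
  | .emit b => .read K'.main true fun o => match o with
    | some Γ'.bit0 => .emitThen b false
    | some Γ'.bit1 => .emitThen b true
    | _ => .final
  | .emitThen b b' => .out b (.emit b')
  | .final => .halt

variable {c} {p : List Bool}

/-- The state of the program corresponding to a label of the evaluating machine. -/
noncomputable def labelState (c : Code) (l : Option Λ') (v : Option Γ') : LoopState c :=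
  l.elim .done fun l => .run (toStm c (tr l)) v

theorem reaches_head {s : LoopState c} {n : ℕ} {stk : K' → List Γ'} {raw o : List Bool}
    {d e : StackCfg K' Γ' (LoopState c)}
    (h : stackStep (loop c) p ⟨s, n, stk, raw, o⟩ = some d)
    (h' : Reaches (stackStep (loop c) p) d e) :
    Reaches (stackStep (loop c) p) ⟨s, n, stk, raw, o⟩ e :=
  Relation.ReflTransGen.head h h'

theorem loop_run {q : TrStmt} (h : some q ∈ stmtSupp c)
    (v : Option Γ') : ∃ h' : some q ∈ stmtSupp c,
      loop c (.run (toStm c q) v) = loop c (.run ⟨some q, h'⟩ v) := by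
  refine ⟨h, ?_⟩
  congr 2
  exact Subtype.ext (toStm_val h)

theorem tr_mem_stmts {l : Λ'} (h : l ∈ codeSupp c Cont'.halt) :
    some (tr l) ∈ stmtSupp c := by
  classical
  exact Finset.some_mem_insertNone.2 (Finset.mem_biUnion.2 ⟨l, h, TM2.stmts₁_self⟩)

/-- Each constructor of a statement is one instruction of the stack program, with the local variable
kept in the finite control. Membership in the support guarantees that `toStm` does not replace the
statement by `none`. -/
theorem reaches_stepAux (q : TrStmt) (h : some q ∈ stmtSupp c)
    (v : Option Γ') (n : ℕ) (stk : K' → List Γ') (raw o : List Bool) :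
    Reaches (stackStep (loop c) p) ⟨.run (toStm c q) v, n, stk, raw, o⟩
      ⟨labelState c (TM2.stepAux q v stk).l (TM2.stepAux q v stk).var, n,
        (TM2.stepAux q v stk).stk, raw, o⟩ := by
  classical
  have hsub : ∀ q', q' ∈ TM2.stmts₁ q → some q' ∈ stmtSupp c :=
    fun q' hq' => TM2.stmts_trans hq' h
  obtain ⟨h', e⟩ := loop_run h v
  induction q generalizing v stk with
  | push k f q ih =>
    have hq := hsub q (by simp [TM2.stmts₁, TM2.stmts₁_self])
    refine reaches_head (by simp only [stackStep, e]; rfl) ?_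
    exact ih hq v _ (fun q' hq' => TM2.stmts_trans hq' hq) (loop_run hq v).1 (loop_run hq v).2
  | peek k f q ih =>
    have hq := hsub q (by simp [TM2.stmts₁, TM2.stmts₁_self])
    refine reaches_head (by simp only [stackStep, e]; rfl) ?_
    exact ih hq _ _ (fun q' hq' => TM2.stmts_trans hq' hq) (loop_run hq v).1 (loop_run hq _).2
  | pop k f q ih =>
    have hq := hsub q (by simp [TM2.stmts₁, TM2.stmts₁_self])
    refine reaches_head (by simp only [stackStep, e]; rfl) ?_
    exact ih hq _ _ (fun q' hq' => TM2.stmts_trans hq' hq) (loop_run hq v).1 (loop_run hq _).2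
  | load a q ih =>
    have hq := hsub q (by simp [TM2.stmts₁, TM2.stmts₁_self])
    refine reaches_head (by simp only [stackStep, e]; rfl) ?_
    exact ih hq _ _ (fun q' hq' => TM2.stmts_trans hq' hq) (loop_run hq v).1 (loop_run hq _).2
  | branch f q₁ q₂ ih₁ ih₂ =>
    have hq₁ := hsub q₁ (by simp [TM2.stmts₁, TM2.stmts₁_self])
    have hq₂ := hsub q₂ (by simp [TM2.stmts₁, TM2.stmts₁_self])
    refine reaches_head (by simp only [stackStep, e]; rfl) ?_
    cases hf : f v with
    | true =>
      simp only [TM2.stepAux, hf, cond_true]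
      exact ih₁ hq₁ _ _ (fun q' hq' => TM2.stmts_trans hq' hq₁) (loop_run hq₁ v).1
        (loop_run hq₁ _).2
    | false =>
      simp only [TM2.stepAux, hf, cond_false]
      exact ih₂ hq₂ _ _ (fun q' hq' => TM2.stmts_trans hq' hq₂) (loop_run hq₂ v).1
        (loop_run hq₂ _).2
  | goto l =>
    exact reaches_head (by simp only [stackStep, e]; rfl) Relation.ReflTransGen.refl
  | halt =>
    exact reaches_head (by simp only [stackStep, e]; rfl) Relation.ReflTransGen.refl

/-- The configuration of the program corresponding to one of the evaluating machine. -/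
noncomputable def loopCfg (n : ℕ) (raw o : List Bool) (a : TrCfg) : StackCfg K' Γ' (LoopState c) :=
  ⟨labelState c a.l a.var, n, a.stk, raw, o⟩

/-- The induction carries along that the label stays in the finite support of the code; otherwise
`toStm` would lose the statement. -/
theorem reaches_loopCfg (n : ℕ) (raw o : List Bool) {a b : TrCfg}
    (ha : a.l ∈ Finset.insertNone (codeSupp c Cont'.halt)) (h : Reaches (TM2.step tr) a b) :
    Reaches (stackStep (loop c) p) (loopCfg n raw o a) (loopCfg n raw o b) := by
  suffices b.l ∈ Finset.insertNone (codeSupp c Cont'.halt) ∧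
    Reaches (stackStep (loop c) p) (loopCfg n raw o a) (loopCfg n raw o b) from this.2
  induction h with
  | refl => exact ⟨ha, Relation.ReflTransGen.refl⟩
  | @tail b d _ hs ih =>
    obtain ⟨hb, hr⟩ := ih
    refine ⟨@TM2.step_supports _ _ _ _ ⟨trNormal c Cont'.halt⟩ _ tr _ (tr_supports c Cont'.halt)
      _ _ hs hb, reaches_trans hr ?_⟩
    obtain ⟨_ | l, v, stk⟩ := b
    · cases hs
    · cases hs
      exact reaches_stepAux _ (tr_mem_stmts (Finset.some_mem_insertNone.1 hb)) _ _ _ _ _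

theorem reaches_eval (n : ℕ) (raw o : List Bool) {v w : List ℕ} (h : w ∈ c.eval v) :
    Reaches (stackStep (loop c) p) ⟨enter c, n, K'.elim (trList v) [] [] [], raw, o⟩
      ⟨.done, n, K'.elim (trList w) [] [] [], raw, o⟩ := by
  have h₁ : PartrecToTM2.halt w ∈ StateTransition.eval (TM2.step tr) (init c v) := by
    rw [PartrecToTM2.tr_eval]
    exact Part.mem_map _ h
  exact reaches_loopCfg n raw o (c := c) (p := p) (a := init c v)
    (Finset.some_mem_insertNone.2 (tr_supports c Cont'.halt).1) (mem_eval.1 h₁).1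

/-- Fetching from the end and pushing preserves the order: the first bit of `y` ends on top. -/
theorem reaches_load (n : ℕ) (y : List Bool) (m : List Γ') (o : List Bool) :
    Reaches (stackStep (loop c) p) ⟨.load, n, K'.elim m [] [] [], y, o⟩
      ⟨.markP, n, K'.elim (y.map bitSym ++ m) [] [] [], [], o⟩ := by
  induction y using List.reverseRecOn generalizing m with
  | nil => exact reaches_head rfl Relation.ReflTransGen.refl
  | append_singleton y b ih =>
    refine reaches_head (d := ⟨.loadBit b, n, K'.elim m [] [] [], y, o⟩)
      (by simp [stackStep, loop]) ?_
    refine reaches_head (d := ⟨.load, n, K'.elim (bitSym b :: m) [] [] [], y, o⟩)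
      (by simp [stackStep, loop]) ?_
    simpa using ih (bitSym b :: m)

theorem reaches_start (y : List Bool) :
    Reaches (stackStep (loop c) p) ⟨.markY, 0, fun _ => [], y, []⟩
      ⟨enter c, 0, K'.elim (trList [bitsCode [], bitsCode y]) [] [] [], [], []⟩ := by
  have e : (fun _ => [] : K' → List Γ') = K'.elim [] [] [] [] := by funext k; cases k <;> rfl
  rw [e]
  refine reaches_head (d := ⟨.endY, 0, K'.elim [Γ'.cons] [] [] [], y, []⟩)
    (by simp [stackStep, loop]) ?_
  refine reaches_head (d := ⟨.load, 0, K'.elim [Γ'.bit1, Γ'.cons] [] [] [], y, []⟩)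
    (by simp [stackStep, loop]) ?_
  refine reaches_trans (reaches_load _ _ _ _) ?_
  refine reaches_head rfl (reaches_head rfl ?_)
  simp [trNat_bitsCode, -bitsCode_nil]
  exact Relation.ReflTransGen.refl

/-- Printing lags one bit behind reading, so that the leading digit 1 of the code, recognized by the
marker after it, is never printed. -/
theorem reaches_emit (n : ℕ) (b : Bool) (l : List Bool) (m : List Γ') (raw o : List Bool) :
    ∃ stk, Reaches (stackStep (loop c) p)
      ⟨.emit b, n, K'.elim (l.map bitSym ++ Γ'.cons :: m) [] [] [], raw, o⟩
      ⟨.final, n, stk, raw, o ++ (b :: l).dropLast⟩ := by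
  induction l generalizing b o with
  | nil =>
    refine ⟨K'.elim m [] [] [], reaches_head (by simp [stackStep, loop]; rfl) ?_⟩
    simp
    exact Relation.ReflTransGen.refl
  | cons b' l ih =>
    obtain ⟨stk, h⟩ := ih b' (o ++ [b])
    refine ⟨stk, ?_⟩
    refine reaches_head (d := ⟨.emitThen b b', n,
      K'.elim (l.map bitSym ++ Γ'.cons :: m) [] [] [], raw, o⟩)
      (by cases b' <;> simp [stackStep, loop, bitSym]) ?_
    refine reaches_head rfl ?_
    simpa using h

theorem reaches_output (n : ℕ) (x : List Bool) (l : List ℕ) (raw : List Bool) :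
    ∃ stk, Reaches (stackStep (loop c) p)
      ⟨.done, n, K'.elim (trList (bitsCode x :: l)) [] [] [], raw, []⟩ ⟨.final, n, stk, raw, x⟩ := by
  obtain ⟨b, t, hx⟩ : ∃ b t, x ++ [true] = b :: t := by
    cases x with
    | nil => exact ⟨true, [], rfl⟩
    | cons b t => exact ⟨b, t ++ [true], rfl⟩
  have e : trList (bitsCode x :: l) = bitSym b :: (t.map bitSym ++ Γ'.cons :: trList l) := by
    have : x.map bitSym ++ [Γ'.bit1] = (x ++ [true]).map bitSym := by simp [bitSym]
    rw [trList, trNat_bitsCode, this, hx]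
    rfl
  obtain ⟨stk, h⟩ := reaches_emit (c := c) (p := p) n b t (trList l) raw []
  refine ⟨stk, ?_⟩
  rw [← hx, List.dropLast_concat, List.nil_append] at h
  refine reaches_head ?_ h
  rw [e]
  cases b <;> simp [stackStep, loop, bitSym]

/-- The result 0 has no digits, so the symbol popped is its end marker and the old arguments remain.
Pushing the new bit updates the code of the reversed program. -/
theorem reaches_read (s : List Bool) (b : Bool) (t : List Bool) (hp : p = s ++ b :: t) (l : List ℕ) :
    Reaches (stackStep (loop c) p)
      ⟨.done, s.length, K'.elim (trList (0 :: bitsCode s.reverse :: l)) [] [] [], [], []⟩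
      ⟨enter c, (s ++ [b]).length,
        K'.elim (trList (bitsCode (s ++ [b]).reverse :: l)) [] [] [], [], []⟩ := by
  refine reaches_head (d := ⟨.scan, s.length, K'.elim (trList (bitsCode s.reverse :: l)) [] [] [],
    [], []⟩) (by simp [stackStep, loop]) ?_
  refine reaches_head (d := ⟨.pushBit b, s.length + 1,
    K'.elim (trList (bitsCode s.reverse :: l)) [] [] [], [], []⟩)
    (by simp [stackStep, loop, SDMachine.scanned, hp]) ?_
  refine reaches_head rfl ?_
  simp [trNat_bitsCode, -bitsCode_cons]
  exact Relation.ReflTransGen.refl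

/-- A program on which the evaluation of `c` asks for more bits until the whole program has been
read, and then returns `x`, makes the loop print `x`. -/
theorem mem_run_loop {x y : List Bool}
    (h₀ : ∀ s b t, p = s ++ b :: t →
      [0, bitsCode s.reverse, bitsCode y] ∈ c.eval [bitsCode s.reverse, bitsCode y])
    (h₁ : [bitsCode x, bitsCode p.reverse, bitsCode y] ∈ c.eval [bitsCode p.reverse, bitsCode y]) :
    x ∈ (stackMachine (loop c) .markY).run p y := by
  have key : ∀ t s, p = s ++ t → ∃ stk, Reaches (stackStep (loop c) p)
      ⟨enter c, s.length, K'.elim (trList [bitsCode s.reverse, bitsCode y]) [] [] [], [], []⟩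
      ⟨.final, p.length, stk, [], x⟩ := by
    intro t
    induction t with
    | nil =>
      intro s hs
      rw [List.append_nil] at hs
      subst hs
      obtain ⟨stk, h⟩ := reaches_output (c := c) (p := p) p.length x
        [bitsCode p.reverse, bitsCode y] []
      exact ⟨stk, reaches_trans (reaches_eval _ _ _ h₁) h⟩
    | cons b t ih =>
      intro s hs
      obtain ⟨stk, h⟩ := ih (s ++ [b]) (by simp [hs])
      refine ⟨stk, reaches_trans (reaches_eval _ _ _ (h₀ s b t hs)) ?_⟩
      exact reaches_trans (reaches_read s b t hs _) h
  obtain ⟨stk, h⟩ := key p [] rfl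
  rw [List.reverse_nil, List.length_nil] at h
  exact mem_run_stackMachine (c := ⟨.final, p.length, stk, [], x⟩)
    (reaches_trans (reaches_start y) h) rfl rfl

end PartrecLoop

/-- Every partial recursive function controlling how a program is read, and what is printed, is
realized by a self-delimiting machine. -/
theorem exists_machine_of_partrec {Z : ℕ → ℕ →. ℕ} (hZ : Partrec₂ Z) :
    ∃ T : SDMachine, ∀ p x y : List Bool,
      (∀ s b t, p = s ++ b :: t → 0 ∈ Z (bitsCode s.reverse) (bitsCode y)) →
      bitsCode x ∈ Z (bitsCode p.reverse) (bitsCode y) → x ∈ T.run p y := by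
  obtain ⟨c, hc⟩ := ToPartrec.Code.exists_code (Nat.Partrec'.part_iff₂.2 hZ)
  -- Consing onto the identity preserves the arguments for the next round.
  have hcode : ∀ a b z, z ∈ Z a b → [z, a, b] ∈ (c.cons ToPartrec.Code.id).eval [a, b] := by
    intro a b z hz
    have := hc (a ::ᵥ b ::ᵥ List.Vector.nil)
    simp only [List.Vector.head_cons, List.Vector.tail_cons] at this
    have hv : (a ::ᵥ b ::ᵥ List.Vector.nil : List.Vector ℕ 2).1 = [a, b] := rfl
    rw [hv] at this
    simp only [ToPartrec.Code.cons_eval, this, ToPartrec.Code.id_eval]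
    simp [hz]
  refine ⟨stackMachine (PartrecLoop.loop (c.cons ToPartrec.Code.id)) .markY, fun p x y h₀ h₁ => ?_⟩
  exact PartrecLoop.mem_run_loop (fun s b t hs => hcode _ _ _ (h₀ s b t hs)) (hcode _ _ _ h₁)

theorem listTape.nil_left_eq (r : List (Option Bool)) : listTape [] r = listTape [none] r := by
  have : ListBlank.mk ([] : List (Option Bool)) = ListBlank.mk [none] :=
    Quotient.sound' (Or.inl ⟨1, rfl⟩ : BlankRel [] [none])
  rw [listTape, this, listTape]

theorem listTape.head_eq (l r : List (Option Bool)) : (listTape l r).head = r.headI := by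
  cases r
  · simp only [head_nil]; rfl
  · simp only [head_cons]; rfl

/-! ### Simulation of a self-delimiting machine by a primitive recursive function -/

/-- Tabulate the values over all of `α` and look up the entry. This handles the finite rule table of
a machine. -/
theorem Primrec.of_forall_finite {α β σ : Type*} [Primcodable α] [Primcodable β] [Primcodable σ]
    [Finite α] {f : α → β → σ} (h : ∀ a, Primrec (f a)) : Primrec₂ f := by
  classical
  have := Fintype.ofFinite α
  have hl : ∀ l : List α, Primrec fun b => l.map fun a => f a b := by
    intro l
    induction l with
    | nil => exact Primrec.const []
    | cons a l ih => exact Primrec.list_cons.comp (h a) ih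
  have h₁ : Primrec fun x : α × β => (Finset.univ.toList.map fun a => f a x.2)[
      Finset.univ.toList.idxOf x.1]? :=
    Primrec.list_getElem?.comp ((hl _).comp Primrec.snd)
      ((Primrec.list_idxOf₁ _).comp Primrec.fst)
  refine Primrec.option_some_iff.1 (h₁.of_eq fun x => ?_)
  have hx : Finset.univ.toList.idxOf x.1 < (Finset.univ : Finset α).toList.length :=
    List.idxOf_lt_length_of_mem (by simp)
  rw [List.getElem?_map, List.getElem?_eq_getElem hx]
  simp

theorem Primrec.nat_pow : Primrec₂ ((· ^ ·) : ℕ → ℕ → ℕ) :=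
  Primrec₂.unpaired'.1 Nat.Primrec.pow

theorem Primrec.nat_log2 : Primrec Nat.log2 := by
  have : Primrec fun n : ℕ => Nat.findGreatest (fun k => 2 ^ k ≤ n) n :=
    Primrec.nat_findGreatest Primrec.id
      (Primrec.nat_le.comp (Primrec.nat_pow.comp (Primrec.const 2) Primrec.snd) Primrec.fst)
  refine this.of_eq fun n => ?_
  rcases Nat.eq_zero_or_pos n with rfl | hn
  · rfl
  · refine (Nat.findGreatest_eq_iff).2 ⟨?_, fun _ => Nat.log2_self_le hn.ne', fun k hk _ => ?_⟩
    · exact (Nat.lt_two_pow_self.trans_le (Nat.log2_self_le hn.ne')).le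
    · rw [Nat.log2_lt hn.ne'] at hk
      exact not_le.2 hk

/-! ### Bit strings as positive integers -/

/-- The inverse of `bitsCode`. -/
def decodeBits (a : ℕ) : List Bool := (List.range a.log2).map fun i => a.testBit i

theorem length_decodeBits (a : ℕ) : (decodeBits a).length = a.log2 := by
  simp [decodeBits]

theorem decodeBits_two_mul_add {a : ℕ} (h : 0 < a) (b : Bool) :
    decodeBits (2 * a + b.toNat) = b :: decodeBits a := by
  have h₁ : (2 * a + b.toNat).log2 = a.log2 + 1 := by
    have := b.toNat_le
    rw [Nat.log2_eq_iff (by omega)]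
    have h₂ := (Nat.log2_eq_iff h.ne').1 rfl
    rw [pow_succ, pow_succ]
    rw [pow_succ] at h₂
    omega
  rw [decodeBits, h₁, List.range_succ_eq_map, List.map_cons, List.map_map, decodeBits]
  congr 1
  · cases b <;> simp [Nat.testBit_zero, Nat.add_mod]
  · refine List.map_congr_left fun i _ => ?_
    have : (2 * a + b.toNat) / 2 = a := by have := b.toNat_lt; omega
    simp [Nat.testBit_succ, this]

theorem decodeBits_bitsCode (l : List Bool) : decodeBits (bitsCode l) = l := by
  induction l with
  | nil => rfl
  | cons b l ih => rw [bitsCode_cons, decodeBits_two_mul_add (bitsCode_pos l), ih]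

theorem bitsCode_decodeBits {a : ℕ} (h : 0 < a) : bitsCode (decodeBits a) = a := by
  induction a using Nat.strong_induction_on with
  | _ a ih =>
    rcases Nat.lt_or_ge a 2 with h2 | h2
    · interval_cases a; rfl
    · obtain ⟨b, hb⟩ : ∃ b : Bool, a = 2 * (a / 2) + b.toNat := by
        rcases Nat.mod_two_eq_zero_or_one a with h0 | h1
        · exact ⟨false, by simp; omega⟩
        · exact ⟨true, by simp; omega⟩
      rw [hb, decodeBits_two_mul_add (by omega), bitsCode_cons, ih _ (by omega) (by omega)]

theorem bitsCode_injective : Function.Injective bitsCode :=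
  Function.LeftInverse.injective decodeBits_bitsCode

theorem log2_bitsCode (l : List Bool) : (bitsCode l).log2 = l.length := by
  rw [← length_decodeBits, decodeBits_bitsCode]

theorem primrec_decodeBits : Primrec decodeBits := by
  have ht : Primrec₂ fun a i : ℕ => a.testBit i := by
    have : Primrec₂ fun a i : ℕ => (a / 2 ^ i).bodd :=
      Primrec.nat_bodd.comp (Primrec.nat_div.comp Primrec.fst
        (Primrec.nat_pow.comp (Primrec.const 2) Primrec.snd))
    refine this.of_eq fun a i => ?_
    rw [Nat.testBit_eq_decide_div_mod_eq, Nat.mod_two_of_bodd]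
    cases (a / 2 ^ i).bodd <;> rfl
  exact Primrec.list_map (Primrec.list_range.comp Primrec.nat_log2) ht

theorem primrec_bitsCode : Primrec bitsCode := by
  refine Primrec.list_foldr (h := fun _ (x : Bool × ℕ) => 2 * x.2 + x.1.toNat) Primrec.id (Primrec.const 1) ?_
  exact Primrec.nat_add.comp
    (Primrec.nat_double.comp (Primrec.snd.comp Primrec.snd))
    ((Primrec.dom_bool Bool.toNat).comp (Primrec.fst.comp Primrec.snd))

namespace SDMachine

variable (U : SDMachine)

instance : Finite U.Q := U.finite_Q

noncomputable instance : Primcodable U.Q := Primcodable.ofEquiv _ (Finite.equivFin U.Q)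

/-- Configurations with the two halves of the work tape given by lists. -/
abbrev LCfg : Type := U.Q × ℕ × List (Option Bool) × List (Option Bool) × List Bool

/-- The configuration given by lists. -/
def ofLCfg (c : U.LCfg) : U.Cfg := ⟨c.1, c.2.1, listTape c.2.2.1 c.2.2.2.1, c.2.2.2.2⟩

/-- The configuration after the next step; a halted machine does not move. -/
def next (p : List Bool) (c : U.Cfg) : U.Cfg := (U.step p c).getD c

/-- The configuration after `t` steps. -/
def cfgAt (p y : List Bool) (t : ℕ) : U.Cfg := (U.next p)^[t] (U.init y)

open Classical in
/-- The code of the output if the machine halts within `t` steps, and `0` otherwise. -/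
noncomputable def outCode (p y : List Bool) (t : ℕ) : ℕ :=
  if U.step p (U.cfgAt p y t) = none then bitsCode (U.cfgAt p y t).output else 0

/-- `next` for list configurations, when the rule for the triple `k` applies. -/
def lact (k : U.Q × Option Bool × Option Bool) (c : U.LCfg) : U.LCfg :=
  match U.rule k.1 k.2.1 k.2.2 with
  | none => c
  | some (.scan, q) => (q, c.2.1 + 1, c.2.2.1, c.2.2.2.1, c.2.2.2.2)
  | some (.move .left, q) => (q, c.2.1, c.2.2.1.tail, c.2.2.1.headI :: c.2.2.2.1, c.2.2.2.2)
  | some (.move .right, q) => (q, c.2.1, c.2.2.2.1.headI :: c.2.2.1, c.2.2.2.1.tail, c.2.2.2.2)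
  | some (.write b, q) => (q, c.2.1, c.2.2.1, b :: c.2.2.2.1.tail, c.2.2.2.2)
  | some (.out b, q) => (q, c.2.1, c.2.2.1, c.2.2.2.1, c.2.2.2.2 ++ [b])

/-- What determines the next step. -/
def lkey (p : List Bool) (c : U.LCfg) : U.Q × Option Bool × Option Bool :=
  (c.1, scanned p c.2.1, c.2.2.2.1.headI)

/-- Lists represent tape halves only up to trailing blanks; an empty half is first replaced by a
single blank, which matches `headI` and `tail`. -/
theorem next_ofLCfg (p : List Bool) (c : U.LCfg) :
    U.next p (U.ofLCfg c) = U.ofLCfg (U.lact (U.lkey p c) c) := by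
  obtain ⟨q, n, l, r, o⟩ := c
  simp only [next, step, ofLCfg, lact, lkey, listTape.head_eq]
  have hl : listTape l r = listTape (l.headI :: l.tail) r := by
    cases l
    · exact listTape.nil_left_eq r
    · rfl
  have hr : listTape l r = listTape l (r.headI :: r.tail) := by
    cases r
    · exact listTape.nil_eq l
    · rfl
  rcases h : U.rule q (scanned p n) r.headI with _ | ⟨_ | ⟨_ | _⟩ | _ | _, q'⟩
  · rfl
  · rfl
  · simp only [Option.map_some, Option.getD_some, act]
    rw [hl]; simp
  · simp only [Option.map_some, Option.getD_some, act]
    rw [hr]; simp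
  · simp only [Option.map_some, Option.getD_some, act]
    rw [hr]; simp
  · rfl

theorem primrec_lact (k : U.Q × Option Bool × Option Bool) : Primrec (U.lact k) := by
  have hn : Primrec fun c : U.LCfg => c.2.1 := Primrec.fst.comp Primrec.snd
  have hl : Primrec fun c : U.LCfg => c.2.2.1 := Primrec.fst.comp (Primrec.snd.comp Primrec.snd)
  have hr : Primrec fun c : U.LCfg => c.2.2.2.1 :=
    Primrec.fst.comp (Primrec.snd.comp (Primrec.snd.comp Primrec.snd))
  have ho : Primrec fun c : U.LCfg => c.2.2.2.2 :=
    Primrec.snd.comp (Primrec.snd.comp (Primrec.snd.comp Primrec.snd))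
  have key : ∀ (q : U.Q) {n : U.LCfg → ℕ} {l r : U.LCfg → List (Option Bool)}
      {o : U.LCfg → List Bool}, Primrec n → Primrec l → Primrec r → Primrec o →
      Primrec fun c => ((q, n c, l c, r c, o c) : U.LCfg) := fun q _ _ _ _ hn hl hr ho =>
    (Primrec.const q).pair (hn.pair (hl.pair (hr.pair ho)))
  unfold lact
  rcases U.rule k.1 k.2.1 k.2.2 with _ | ⟨_ | ⟨_ | _⟩ | b | b, q⟩
  · exact Primrec.id
  · exact key q (Primrec.succ.comp hn) hl hr ho
  · exact key q hn (Primrec.list_tail.comp hl)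
      (Primrec.list_cons.comp (Primrec.list_headI.comp hl) hr) ho
  · exact key q hn (Primrec.list_cons.comp (Primrec.list_headI.comp hr) hl)
      (Primrec.list_tail.comp hr) ho
  · exact key q hn hl (Primrec.list_cons.comp (Primrec.const b) (Primrec.list_tail.comp hr)) ho
  · exact key q hn hl hr (Primrec.list_append.comp ho (Primrec.const [b]))

theorem primrec_scanned : Primrec₂ scanned := by
  have : Primrec₂ fun (p : List Bool) (n : ℕ) =>
      (Nat.casesOn n none fun m => p[m]? : Option Bool) :=
    Primrec.nat_casesOn Primrec.snd (Primrec.const none)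
      (Primrec.list_getElem?.comp (Primrec.fst.comp Primrec.fst) Primrec.snd)
  exact this.of_eq fun p n => by cases n <;> rfl

theorem primrec_lkey : Primrec₂ U.lkey :=
  (Primrec.fst.comp Primrec.snd).pair
    ((primrec_scanned.comp Primrec.fst (Primrec.fst.comp (Primrec.snd.comp Primrec.snd))).pair
      (Primrec.list_headI.comp (Primrec.fst.comp (Primrec.snd.comp (Primrec.snd.comp
        (Primrec.snd.comp Primrec.snd))))))

/-- The list configuration after `t` steps. -/
def lcfgAt (p y : List Bool) (t : ℕ) : U.LCfg :=
  (fun c => U.lact (U.lkey p c) c)^[t] (U.start, 0, [], y.map some, [])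

theorem cfgAt_eq (p y : List Bool) (t : ℕ) : U.cfgAt p y t = U.ofLCfg (U.lcfgAt p y t) := by
  have h : Function.Semiconj U.ofLCfg (fun c => U.lact (U.lkey p c) c) (U.next p) :=
    fun c => (U.next_ofLCfg p c).symm
  exact (h.iterate_right t (U.start, 0, [], y.map some, [])).symm

theorem outCode_eq (p y : List Bool) (t : ℕ) : U.outCode p y t =
    if U.rule (U.lkey p (U.lcfgAt p y t)).1 (U.lkey p (U.lcfgAt p y t)).2.1
      (U.lkey p (U.lcfgAt p y t)).2.2 = none then bitsCode (U.lcfgAt p y t).2.2.2.2 else 0 := by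
  rw [outCode, cfgAt_eq]
  simp only [step, ofLCfg, lkey, listTape.head_eq, Option.map_eq_none_iff]
  congr

theorem primrec_outCode : Primrec fun x : (List Bool × List Bool) × ℕ =>
    U.outCode x.1.1 x.1.2 x.2 := by
  have hinit : Primrec fun x : (List Bool × List Bool) × ℕ =>
      ((U.start, 0, [], x.1.2.map some, []) : U.LCfg) :=
    (Primrec.const U.start).pair ((Primrec.const 0).pair ((Primrec.const []).pair
      ((Primrec.list_map (Primrec.snd.comp Primrec.fst)
        (Primrec.option_some.comp Primrec.snd).to₂).pair (Primrec.const []))))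
  have hstep : Primrec₂ fun (x : (List Bool × List Bool) × ℕ) (c : U.LCfg) =>
      U.lact (U.lkey x.1.1 c) c :=
    (Primrec.of_forall_finite U.primrec_lact).comp
      (U.primrec_lkey.comp (Primrec.fst.comp (Primrec.fst.comp Primrec.fst)) Primrec.snd)
      Primrec.snd
  have hcfg : Primrec fun x : (List Bool × List Bool) × ℕ => U.lcfgAt x.1.1 x.1.2 x.2 :=
    Primrec.nat_iterate Primrec.snd hinit hstep
  have hhalt : PrimrecPred fun k : U.Q × Option Bool × Option Bool => U.rule k.1 k.2.1 k.2.2 = none := by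
    classical
    exact Primrec.primrecPred (Primrec.dom_finite _)
  refine (Primrec.ite (hhalt.comp (U.primrec_lkey.comp (Primrec.fst.comp Primrec.fst) hcfg))
    (primrec_bitsCode.comp (Primrec.snd.comp (Primrec.snd.comp (Primrec.snd.comp
      (Primrec.snd.comp hcfg))))) (Primrec.const 0)).of_eq fun x => ?_
  rw [outCode_eq]

/-! ### Elementary properties of the computations of a self-delimiting machine -/

theorem cfgAt_zero (p y : List Bool) : U.cfgAt p y 0 = U.init y := rfl

theorem cfgAt_succ (p y : List Bool) (t : ℕ) : U.cfgAt p y (t + 1) = U.next p (U.cfgAt p y t) :=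
  Function.iterate_succ_apply' _ _ _

variable {U}

theorem pos_le_pos_next (p : List Bool) (c : U.Cfg) : c.pos ≤ (U.next p c).pos := by
  simp only [next, step]
  rcases U.rule c.state (scanned p c.pos) c.work.head with _ | ⟨_ | _ | _ | _, q⟩ <;> simp [act]

theorem pos_next_le (p : List Bool) (c : U.Cfg) : (U.next p c).pos ≤ c.pos + 1 := by
  simp only [next, step]
  rcases U.rule c.state (scanned p c.pos) c.work.head with _ | ⟨_ | _ | _ | _, q⟩ <;> simp [act]

theorem pos_cfgAt_le (p y : List Bool) (t : ℕ) : (U.cfgAt p y t).pos ≤ t := by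
  induction t with
  | zero => simp [cfgAt_zero, init]
  | succ t ih => rw [cfgAt_succ]; have := pos_next_le p (U.cfgAt p y t); omega

theorem step_append (p q : List Bool) {c : U.Cfg} (h : c.pos ≤ p.length) :
    U.step (p ++ q) c = U.step p c := by
  have : scanned (p ++ q) c.pos = scanned p c.pos := by
    cases hc : c.pos with
    | zero => rfl
    | succ n => exact List.getElem?_append_left (by omega)
  rw [step, this, step]

/-- A computation cannot depend on cells that it has not scanned, and the program head never moves
back. -/
theorem cfgAt_append (p q y : List Bool) {t : ℕ} (h : (U.cfgAt p y t).pos ≤ p.length) :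
    U.cfgAt (p ++ q) y t = U.cfgAt p y t := by
  induction t with
  | zero => rfl
  | succ t ih =>
    rw [cfgAt_succ] at h
    have h' := (pos_le_pos_next p _).trans h
    rw [cfgAt_succ, cfgAt_succ, ih h', next, step_append p q h', next]

theorem cfgAt_of_halted {p y : List Bool} {t t' : ℕ} (h : U.step p (U.cfgAt p y t) = none)
    (ht : t ≤ t') : U.cfgAt p y t' = U.cfgAt p y t := by
  induction t', ht using Nat.le_induction with
  | base => rfl
  | succ t' _ ih => rw [cfgAt_succ, ih, next, h]; rfl

theorem outCode_append {p y : List Bool} {t t' : ℕ} (h : U.step p (U.cfgAt p y t) = none)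
    (hp : (U.cfgAt p y t).pos ≤ p.length) (q : List Bool) (ht : t ≤ t') :
    U.outCode (p ++ q) y t' = bitsCode (U.cfgAt p y t).output := by
  have h₁ : U.cfgAt (p ++ q) y t' = U.cfgAt p y t := by
    rw [cfgAt_append p q y (by rwa [cfgAt_of_halted h ht]), cfgAt_of_halted h ht]
  rw [outCode, h₁, step_append p q hp, if_pos h]

/-- A machine that has halted within `|p|` steps does the same on longer programs. -/
theorem outCode_concat {p y : List Bool} (h : U.outCode p y p.length ≠ 0) (b : Bool) :
    U.outCode (p ++ [b]) y (p.length + 1) = U.outCode p y p.length := by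
  have hs : U.step p (U.cfgAt p y p.length) = none := by
    by_contra hs
    exact h (by rw [outCode, if_neg hs])
  rw [outCode_append hs (pos_cfgAt_le _ _ _) [b] (Nat.le_succ _), outCode, if_pos hs]

theorem exists_cfgAt_of_mem_run {p x y : List Bool} (h : x ∈ U.run p y) :
    ∃ t, U.step p (U.cfgAt p y t) = none ∧ (U.cfgAt p y t).pos = p.length ∧
      (U.cfgAt p y t).output = x := by
  simp only [run, Part.mem_bind_iff, Part.mem_assert_iff, Part.mem_some_iff, mem_eval] at h
  obtain ⟨c, ⟨hr, hc⟩, hp, hx⟩ := h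
  suffices ∃ t, U.cfgAt p y t = c by
    obtain ⟨t, rfl⟩ := this
    exact ⟨t, hc, hp, hx.symm⟩
  clear hc hp hx
  induction hr with
  | refl => exact ⟨0, rfl⟩
  | tail _ hs ih =>
    obtain ⟨t, rfl⟩ := ih
    refine ⟨t + 1, ?_⟩
    rw [cfgAt_succ, next, hs]
    rfl

theorem exists_outCode_eq {p x y : List Bool} (h : x ∈ U.run p y) :
    ∃ t₀, ∀ q t, t₀ ≤ t → U.outCode (p ++ q) y t = bitsCode x := by
  obtain ⟨t, hs, hp, rfl⟩ := exists_cfgAt_of_mem_run h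
  exact ⟨t, fun q t' ht => outCode_append hs hp.le q ht⟩

/-- Prefix-freeness: both halted configurations belong to the same run on the common extension, and
the head position in them is the length of the respective program. -/
theorem eq_of_append_eq {p p' q q' x x' y : List Bool} (h : x ∈ U.run p y) (h' : x' ∈ U.run p' y)
    (e : p ++ q = p' ++ q') : p = p' := by
  obtain ⟨t, hs, hp, -⟩ := exists_cfgAt_of_mem_run h
  obtain ⟨t', hs', hp', -⟩ := exists_cfgAt_of_mem_run h'
  have h₁ : U.cfgAt (p ++ q) y (max t t') = U.cfgAt p y t := by
    rw [cfgAt_append p q y (by rw [cfgAt_of_halted hs (le_max_left _ _)]; exact hp.le),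
      cfgAt_of_halted hs (le_max_left _ _)]
  have h₂ : U.cfgAt (p' ++ q') y (max t t') = U.cfgAt p' y t' := by
    rw [cfgAt_append p' q' y (by rw [cfgAt_of_halted hs' (le_max_right _ _)]; exact hp'.le),
      cfgAt_of_halted hs' (le_max_right _ _)]
  rw [e, h₂] at h₁
  exact List.append_inj_left e (by rw [← hp, ← hp', h₁])

end SDMachine

/-! ### The weights of the events -/

/-- The largest power of two below `n`, and `0` for `n = 0`. -/
def topPow (n : ℕ) : ℕ := if n = 0 then 0 else 2 ^ n.log2

theorem topPow_le (n : ℕ) : topPow n ≤ n := by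
  rw [topPow]
  split_ifs with h
  · exact Nat.zero_le n
  · exact Nat.log2_self_le h

theorem le_two_mul_topPow (n : ℕ) : n ≤ 2 * topPow n := by
  rw [topPow]
  split_ifs with h
  · omega
  · have := (Nat.log2_lt h).1 (Nat.lt_succ_self _)
    rw [pow_succ] at this
    omega

theorem topPow_mono {a b : ℕ} (h : a ≤ b) : topPow a ≤ topPow b := by
  rcases Nat.eq_zero_or_pos a with rfl | ha
  · simp [topPow]
  · rw [topPow, topPow, if_neg ha.ne', if_neg (by omega)]
    refine Nat.pow_le_pow_right (by norm_num) ?_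
    exact (Nat.le_log2 (by omega)).2 ((Nat.log2_self_le ha.ne').trans h)

theorem topPow_two_mul (a : ℕ) : topPow (2 * a) = 2 * topPow a := by
  rcases Nat.eq_zero_or_pos a with rfl | ha
  · simp [topPow]
  · rw [topPow, topPow, if_neg ha.ne', if_neg (by omega), Nat.log2_two_mul ha.ne', pow_succ,
      mul_comm]

/-- Distinct powers of two differ by a factor of at least 2; this is the purpose of the rounding. -/
theorem two_mul_topPow_le_of_lt {a b : ℕ} (h : topPow a < topPow b) :
    2 * topPow a ≤ topPow b := by
  rw [topPow, topPow] at *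
  split_ifs at * with h₁ h₂ h₂
  · omega
  · omega
  · omega
  · rw [← pow_succ']
    exact Nat.pow_le_pow_right (by norm_num) ((Nat.pow_lt_pow_iff_right (by norm_num)).1 h)

theorem primrec_topPow : Primrec topPow :=
  Primrec.ite (Primrec.eq.comp Primrec.id (Primrec.const 0)) (Primrec.const 0)
    (Primrec.nat_pow.comp (Primrec.const 2) Primrec.nat_log2)

namespace SDMachine

variable (U : SDMachine)

/-- The number of programs of length `t` with output code `m` after `t` steps, for the auxiliary
string with code `b`. -/
noncomputable def outCount (b t m : ℕ) : ℕ :=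
  ((Finset.range (2 ^ t)).filter fun j =>
    U.outCode (decodeBits (2 ^ t + j)) (decodeBits b) t = m).card

/-- The scaled weight of the event that the programs of length `t` have been run for `t` steps,
for the output with code `m`. -/
noncomputable def stageWeight (b t m : ℕ) : ℕ :=
  topPow (U.outCount b t m) - Nat.casesOn t 0 fun s => 2 * topPow (U.outCount b s m)

/-- The scaled weight of the `n`-th event. -/
noncomputable def eventWeight (b n : ℕ) : ℕ :=
  U.stageWeight b n.unpair.1 (n.unpair.2 + 1)

/-- The sum of the weights of the events before `n`, scaled by `2 ^ n`. -/
noncomputable def totalWeight (b n : ℕ) : ℕ :=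
  Nat.rec 0 (fun n s => 2 * s + 2 ^ (n + 1 - n.unpair.1) * U.eventWeight b n) n

theorem primrec_outCount : Primrec fun x : ℕ × ℕ × ℕ => U.outCount x.1 x.2.1 x.2.2 := by
  have hR : PrimrecRel fun (j : ℕ) (x : ℕ × ℕ × ℕ) =>
      U.outCode (decodeBits (2 ^ x.2.1 + j)) (decodeBits x.1) x.2.1 = x.2.2 := by
    have ht : Primrec fun z : ℕ × ℕ × ℕ × ℕ => z.2.2.1 :=
      Primrec.fst.comp (Primrec.snd.comp Primrec.snd)
    refine Primrec.eq.comp (U.primrec_outCode.comp (((primrec_decodeBits.comp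
      (Primrec.nat_add.comp (Primrec.nat_pow.comp (Primrec.const 2) ht) Primrec.fst)).pair
      (primrec_decodeBits.comp (Primrec.fst.comp Primrec.snd))).pair ht)) ?_
    exact Primrec.snd.comp (Primrec.snd.comp Primrec.snd)
  have := Primrec.list_length.comp ((PrimrecRel.listFilter hR).comp
    (Primrec.list_range.comp (Primrec.nat_pow.comp (Primrec.const 2)
      (Primrec.fst.comp (Primrec.snd (α := ℕ) (β := ℕ × ℕ))))) Primrec.id)
  exact this.of_eq fun x => rfl

theorem primrec_stageWeight : Primrec fun x : ℕ × ℕ × ℕ => U.stageWeight x.1 x.2.1 x.2.2 := by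
  have h : Primrec fun x : ℕ × ℕ × ℕ => topPow (U.outCount x.1 x.2.1 x.2.2) :=
    primrec_topPow.comp U.primrec_outCount
  have h' : Primrec₂ fun (x : ℕ × ℕ × ℕ) (s : ℕ) => 2 * topPow (U.outCount x.1 s x.2.2) := by
    have hx : Primrec fun z : (ℕ × ℕ × ℕ) × ℕ => (z.1.1, z.2, z.1.2.2) :=
      (Primrec.fst.comp Primrec.fst).pair
        (Primrec.snd.pair (Primrec.snd.comp (Primrec.snd.comp Primrec.fst)))
    have h₂ := h.comp hx
    exact Primrec.nat_mul.comp (Primrec.const 2) h₂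
  have h'' : Primrec fun x : ℕ × ℕ × ℕ =>
      (Nat.casesOn x.2.1 0 fun s => 2 * topPow (U.outCount x.1 s x.2.2) : ℕ) :=
    Primrec.nat_casesOn (Primrec.fst.comp Primrec.snd) (Primrec.const 0) h'
  exact (Primrec.nat_sub.comp h h'').of_eq fun x => by rw [stageWeight]

theorem primrec_eventWeight : Primrec₂ U.eventWeight := by
  have hu : Primrec fun x : ℕ × ℕ => x.2.unpair := Primrec.unpair.comp Primrec.snd
  have hx : Primrec fun x : ℕ × ℕ => (x.1, x.2.unpair.1, x.2.unpair.2 + 1) :=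
    Primrec.fst.pair ((Primrec.fst.comp hu).pair (Primrec.succ.comp (Primrec.snd.comp hu)))
  exact (U.primrec_stageWeight.comp hx).of_eq fun x => by rw [eventWeight]

theorem primrec_totalWeight : Primrec₂ U.totalWeight := by
  have hn : Primrec fun z : (ℕ × ℕ) × ℕ × ℕ => z.2.1 := Primrec.fst.comp Primrec.snd
  have he : Primrec fun z : (ℕ × ℕ) × ℕ × ℕ => U.eventWeight z.1.1 z.2.1 :=
    U.primrec_eventWeight.comp (Primrec.fst.comp Primrec.fst) hn
  have hp : Primrec fun z : (ℕ × ℕ) × ℕ × ℕ => 2 ^ (z.2.1 + 1 - z.2.1.unpair.1) :=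
    Primrec.nat_pow.comp (Primrec.const 2) (Primrec.nat_sub.comp (Primrec.succ.comp hn)
      (Primrec.fst.comp (Primrec.unpair.comp hn)))
  have hs : Primrec₂ fun (x : ℕ × ℕ) (z : ℕ × ℕ) =>
      2 * z.2 + 2 ^ (z.1 + 1 - z.1.unpair.1) * U.eventWeight x.1 z.1 :=
    Primrec.nat_add.comp
      (Primrec.nat_mul.comp (Primrec.const 2) (Primrec.snd.comp Primrec.snd))
      (Primrec.nat_mul.comp hp he)
  exact Primrec.nat_rec' Primrec.snd (Primrec.const 0) hs

/-- The action of the decoding machine on the cylinder with code `a`: the first event whose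
interval reaches beyond the left end of the cylinder is found, and its output is printed if the
interval covers the cylinder. -/
noncomputable def decodeStep (a b : ℕ) : Part ℕ :=
  (Nat.rfind fun n => Part.some (decide
    (a * 2 ^ (n + 1) < 2 ^ a.log2 * (U.totalWeight b (n + 1) + 2 ^ (n + 1))))).map fun n =>
    if (a + 1) * 2 ^ (n + 1) ≤ 2 ^ a.log2 * (U.totalWeight b (n + 1) + 2 ^ (n + 1))
    then n.unpair.2 + 1 else 0

theorem partrec_decodeStep : Partrec₂ U.decodeStep := by
  have ha : Primrec fun x : (ℕ × ℕ) × ℕ => x.1.1 := Primrec.fst.comp Primrec.fst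
  have hp : Primrec fun x : (ℕ × ℕ) × ℕ => 2 ^ (x.2 + 1) :=
    Primrec.nat_pow.comp (Primrec.const 2) (Primrec.succ.comp Primrec.snd)
  have hs : Primrec fun x : (ℕ × ℕ) × ℕ =>
      2 ^ x.1.1.log2 * (U.totalWeight x.1.2 (x.2 + 1) + 2 ^ (x.2 + 1)) :=
    Primrec.nat_mul.comp (Primrec.nat_pow.comp (Primrec.const 2) (Primrec.nat_log2.comp ha))
      (Primrec.nat_add.comp (U.primrec_totalWeight.comp (Primrec.snd.comp Primrec.fst)
        (Primrec.succ.comp Primrec.snd)) hp)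
  have h₁ : Primrec fun x : (ℕ × ℕ) × ℕ => decide (x.1.1 * 2 ^ (x.2 + 1) <
      2 ^ x.1.1.log2 * (U.totalWeight x.1.2 (x.2 + 1) + 2 ^ (x.2 + 1))) :=
    (Primrec.nat_lt.comp (Primrec.nat_mul.comp ha hp) hs).decide
  have h₂ : Primrec fun x : (ℕ × ℕ) × ℕ => if (x.1.1 + 1) * 2 ^ (x.2 + 1) ≤
      2 ^ x.1.1.log2 * (U.totalWeight x.1.2 (x.2 + 1) + 2 ^ (x.2 + 1))
      then x.2.unpair.2 + 1 else 0 :=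
    Primrec.ite (Primrec.nat_le.comp (Primrec.nat_mul.comp (Primrec.succ.comp ha) hp) hs)
      (Primrec.succ.comp (Primrec.snd.comp (Primrec.unpair.comp Primrec.snd))) (Primrec.const 0)
  exact (Partrec.rfind h₁.to_comp.partrec.to₂).map h₂.to_comp.to₂

end SDMachine

theorem bitsCode_append (l u : List Bool) :
    bitsCode (l ++ u) + 2 ^ l.length = bitsCode l + 2 ^ l.length * bitsCode u := by
  induction l with
  | nil => simp; ring
  | cons b l ih =>
    simp only [List.cons_append, bitsCode_cons, List.length_cons, pow_succ]
    nlinarith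

theorem two_pow_le_bitsCode (l : List Bool) : 2 ^ l.length ≤ bitsCode l := by
  rw [← log2_bitsCode]
  exact Nat.log2_self_le (bitsCode_pos l).ne'

theorem bitsCode_lt (l : List Bool) : bitsCode l < 2 ^ (l.length + 1) := by
  rw [← Nat.log2_lt (bitsCode_pos l).ne', log2_bitsCode]
  exact Nat.lt_succ_self _

theorem log2_two_pow_add {t j : ℕ} (h : j < 2 ^ t) : (2 ^ t + j).log2 = t := by
  rw [Nat.log2_eq_iff (by positivity), pow_succ]
  omega

/-! ### Monotonicity and total mass of the event weights -/

namespace SDMachine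

variable (U : SDMachine) (b : ℕ)

/-- A program counted at time `t` has halted, so both of its one-bit extensions are counted at time
`t + 1`. Code 0 is excluded because it means that the machine has not halted. -/
theorem two_mul_outCount_le (t : ℕ) {m : ℕ} (hm : m ≠ 0) :
    2 * U.outCount b t m ≤ U.outCount b (t + 1) m := by
  have hdec : ∀ j < 2 ^ t, ∀ β : Bool, decodeBits (2 ^ (t + 1) + (j + β.toNat * 2 ^ t)) =
      decodeBits (2 ^ t + j) ++ [β] := by
    intro j hj β
    have hl : (decodeBits (2 ^ t + j)).length = t := by
      rw [length_decodeBits, log2_two_pow_add hj]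
    have := bitsCode_append (decodeBits (2 ^ t + j)) [β]
    rw [hl, bitsCode_decodeBits (by positivity), bitsCode_cons, bitsCode_nil] at this
    rw [← decodeBits_bitsCode (decodeBits (2 ^ t + j) ++ [β])]
    congr 1
    rw [pow_succ]
    nlinarith
  have hcard : 2 * U.outCount b t m = (((Finset.range (2 ^ t)).filter fun j =>
      U.outCode (decodeBits (2 ^ t + j)) (decodeBits b) t = m) ×ˢ
      (Finset.univ : Finset Bool)).card := by
    rw [Finset.card_product, Finset.card_univ, Fintype.card_bool, mul_comm, outCount]
  rw [hcard, outCount]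
  -- The least significant digit comes first, so an appended bit is the digit of weight `2 ^ t`.
  refine Finset.card_le_card_of_injOn (fun x => x.1 + x.2.toNat * 2 ^ t) ?_ ?_
  · rintro ⟨j, β⟩ hx
    simp only [Finset.coe_product, Set.mem_prod, Finset.mem_coe, Finset.mem_filter,
      Finset.mem_range] at hx ⊢
    obtain ⟨⟨hj, ho⟩, -⟩ := hx
    have hl : (decodeBits (2 ^ t + j)).length = t := by
      rw [length_decodeBits, log2_two_pow_add hj]
    refine ⟨?_, ?_⟩
    · rw [pow_succ]
      cases β <;> simp <;> omega
    · rw [hdec j hj]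
      have := outCode_concat (U := U) (p := decodeBits (2 ^ t + j)) (y := decodeBits b)
        (by rw [hl, ho]; exact hm) β
      rw [hl] at this
      rw [this, ho]
  · rintro ⟨j, β⟩ hx ⟨j', β'⟩ hx' h
    simp only [Finset.coe_product, Set.mem_prod, Finset.mem_coe, Finset.mem_filter,
      Finset.mem_range] at hx hx' h
    have hj := hx.1.1
    have hj' := hx'.1.1
    cases β <;> cases β' <;> simp at h ⊢ <;> omega

theorem sum_outCount_le (t n : ℕ) :
    ∑ m ∈ Finset.range n, U.outCount b t (m + 1) ≤ 2 ^ t := by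
  simp only [outCount]
  rw [← Finset.card_biUnion]
  · conv_rhs => rw [← Finset.card_range (2 ^ t)]
    exact Finset.card_le_card (Finset.biUnion_subset.2 fun m _ => Finset.filter_subset _ _)
  · intro m _ m' _ hne
    refine Finset.disjoint_left.2 fun j hj hj' => hne ?_
    exact Nat.succ_injective ((Finset.mem_filter.1 hj).2.symm.trans (Finset.mem_filter.1 hj').2)

/-- The weight of the output with code `m` among the programs run for `t` steps, rounded down to a
power of two. -/
noncomputable def level (t m : ℕ) : ℝ := (topPow (U.outCount b t m) : ℝ) / 2 ^ t

/-- This makes the truncated subtraction in `stageWeight` exact, so that the weights telescope. -/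
theorem two_mul_topPow_outCount_le (t : ℕ) {m : ℕ} (hm : m ≠ 0) :
    2 * topPow (U.outCount b t m) ≤ topPow (U.outCount b (t + 1) m) := by
  rw [← topPow_two_mul]
  exact topPow_mono (U.two_mul_outCount_le b t hm)

theorem stageWeight_zero (m : ℕ) : (U.stageWeight b 0 m : ℝ) / 2 ^ 0 = U.level b 0 m := by
  simp [stageWeight, level]

theorem stageWeight_succ (t : ℕ) {m : ℕ} (hm : m ≠ 0) :
    (U.stageWeight b (t + 1) m : ℝ) / 2 ^ (t + 1) = U.level b (t + 1) m - U.level b t m := by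
  simp only [stageWeight, level]
  rw [Nat.cast_sub (U.two_mul_topPow_outCount_le b t hm)]
  push_cast
  rw [pow_succ]
  field_simp

theorem sum_stageWeight (T : ℕ) {m : ℕ} (hm : m ≠ 0) :
    ∑ t ∈ Finset.range (T + 1), (U.stageWeight b t m : ℝ) / 2 ^ t = U.level b T m := by
  induction T with
  | zero => rw [Finset.sum_range_one, stageWeight_zero]
  | succ T ih => rw [Finset.sum_range_succ, ih, stageWeight_succ U b T hm]; ring

/-- The sum of the weights of the events before `n`. -/
noncomputable def weightBelow (n : ℕ) : ℝ := (U.totalWeight b n : ℝ) / 2 ^ n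

theorem weightBelow_succ (n : ℕ) : U.weightBelow b (n + 1) =
    U.weightBelow b n + (U.eventWeight b n : ℝ) / 2 ^ n.unpair.1 := by
  have h : U.totalWeight b (n + 1) =
    2 * U.totalWeight b n + 2 ^ (n + 1 - n.unpair.1) * U.eventWeight b n := rfl
  -- The scale `2 ^ (n + 1)` clears the denominator of the `n`-th event.
  have hn : n.unpair.1 ≤ n + 1 := (Nat.unpair_left_le n).trans (Nat.le_succ n)
  have hp : (2 : ℝ) ^ (n + 1) = 2 ^ (n + 1 - n.unpair.1) * 2 ^ n.unpair.1 := by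
    rw [← pow_add, Nat.sub_add_cancel hn]
  rw [weightBelow, weightBelow, h]
  push_cast
  rw [add_div, hp, mul_div_mul_left _ _ (by positivity), ← hp, pow_succ, mul_comm,
    mul_div_mul_right _ _ (by norm_num)]

theorem weightBelow_mono : Monotone (U.weightBelow b) :=
  monotone_nat_of_le_succ fun n => by
    rw [weightBelow_succ]
    exact le_add_of_nonneg_right (by positivity)

theorem weightBelow_nonneg (n : ℕ) : 0 ≤ U.weightBelow b n := by
  rw [weightBelow]; positivity

theorem weightBelow_eq_sum (n : ℕ) : U.weightBelow b n =
    ∑ i ∈ Finset.range n, (U.eventWeight b i : ℝ) / 2 ^ i.unpair.1 := by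
  induction n with
  | zero => simp [weightBelow, totalWeight]
  | succ n ih => rw [weightBelow_succ, ih, Finset.sum_range_succ]

/-- The events before `T + 1` lie in a square of pairs (time, output). Over each output the weights
telescope to the level at time `T`, and the levels are bounded by the proportions of disjoint sets
of programs. -/
theorem weightBelow_le_one (n : ℕ) : U.weightBelow b n ≤ 1 := by
  suffices ∀ T, U.weightBelow b (T + 1) ≤ 1 from
    (U.weightBelow_mono b (Nat.le_succ n)).trans (this n)
  intro T
  obtain ⟨F, hF⟩ : ∃ F : ℕ × ℕ → ℝ, ∀ t m, F (t, m) = (U.stageWeight b t (m + 1) : ℝ) / 2 ^ t :=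
    ⟨fun x => (U.stageWeight b x.1 (x.2 + 1) : ℝ) / 2 ^ x.1, fun _ _ => rfl⟩
  calc U.weightBelow b (T + 1)
      = ∑ i ∈ Finset.range (T + 1), F i.unpair := by
        rw [weightBelow_eq_sum]
        exact Finset.sum_congr rfl fun i _ => (hF _ _).symm
    _ = ∑ x ∈ (Finset.range (T + 1)).map Nat.pairEquiv.symm.toEmbedding, F x := by
        rw [Finset.sum_map]; rfl
    _ ≤ ∑ x ∈ Finset.range (T + 1) ×ˢ Finset.range (T + 1), F x := by
        refine Finset.sum_le_sum_of_subset_of_nonneg ?_ fun ⟨t, m⟩ _ _ => by rw [hF]; positivity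
        intro x hx
        obtain ⟨i, hi, rfl⟩ := Finset.mem_map.1 hx
        rw [Finset.mem_range] at hi
        exact Finset.mem_product.2 ⟨Finset.mem_range.2 ((Nat.unpair_left_le i).trans_lt hi),
          Finset.mem_range.2 ((Nat.unpair_right_le i).trans_lt hi)⟩
    _ = ∑ m ∈ Finset.range (T + 1), U.level b T (m + 1) := by
        rw [Finset.sum_product_right]
        refine Finset.sum_congr rfl fun m _ => ?_
        rw [← sum_stageWeight U b T (Nat.succ_ne_zero m)]
        exact Finset.sum_congr rfl fun t _ => hF t m
    _ ≤ ∑ m ∈ Finset.range (T + 1), (U.outCount b T (m + 1) : ℝ) / 2 ^ T := by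
        refine Finset.sum_le_sum fun m _ => ?_
        rw [level]
        gcongr
        exact topPow_le _
    _ ≤ 1 := by
        rw [← Finset.sum_div, div_le_one (by positivity)]
        exact_mod_cast U.sum_outCount_le b T (T + 1)

/-- Some event for the output with code `m` has at least a quarter of its weight. -/
theorem exists_outCount_le_eventWeight (T : ℕ) {m : ℕ} (h : 0 < U.outCount b T (m + 1)) :
    ∃ n, n.unpair.2 = m ∧ (U.outCount b T (m + 1) : ℝ) / 2 ^ T ≤
      4 * ((U.eventWeight b n : ℝ) / 2 ^ n.unpair.1) ∧ 0 < U.eventWeight b n := by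
  classical
  have hex : ∃ t, U.level b T (m + 1) ≤ U.level b t (m + 1) := ⟨T, le_rfl⟩
  have hpos : 0 < U.level b T (m + 1) := by
    have := le_two_mul_topPow (U.outCount b T (m + 1))
    have : 0 < topPow (U.outCount b T (m + 1)) := by omega
    rw [level]
    positivity
  have hT : (U.outCount b T (m + 1) : ℝ) / 2 ^ T ≤ 2 * U.level b T (m + 1) := by
    rw [level, ← mul_div_assoc]
    gcongr
    exact_mod_cast le_two_mul_topPow _
  obtain ⟨t, ht⟩ : ∃ t, U.level b T (m + 1) ≤
      2 * ((U.stageWeight b t (m + 1) : ℝ) / 2 ^ t) := by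
    -- At the first time the level of time `T` is reached, the level has at least doubled or the
    -- time is 0; in both cases the increment is at least half of the new level.
    refine ⟨Nat.find hex, ?_⟩
    have hge := Nat.find_spec hex
    rcases hf : Nat.find hex with _ | s
    · rw [hf] at hge
      rw [stageWeight_zero]
      linarith
    · rw [hf] at hge
      have hlt : U.level b s (m + 1) < U.level b T (m + 1) :=
        not_le.1 (Nat.find_min hex (by omega))
      have hlt' : U.level b s (m + 1) < U.level b (s + 1) (m + 1) := hlt.trans_le hge
      rw [stageWeight_succ U b s (Nat.succ_ne_zero m)]
      suffices 2 * U.level b s (m + 1) ≤ U.level b (s + 1) (m + 1) by linarith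
      simp only [level] at hlt' ⊢
      rw [pow_succ] at hlt' ⊢
      have h₁ : topPow (2 * U.outCount b s (m + 1)) < topPow (U.outCount b (s + 1) (m + 1)) := by
        rw [topPow_two_mul]
        rw [div_lt_div_iff₀ (by positivity) (by positivity)] at hlt'
        have : (2 * topPow (U.outCount b s (m + 1)) : ℝ) < topPow (U.outCount b (s + 1) (m + 1)) := by
          have hp : (0 : ℝ) < 2 ^ s := by positivity
          nlinarith
        exact_mod_cast this
      have h₂ := two_mul_topPow_le_of_lt h₁
      rw [topPow_two_mul] at h₂
      have h₃ : (2 * (2 * topPow (U.outCount b s (m + 1))) : ℝ) ≤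
        topPow (U.outCount b (s + 1) (m + 1)) := by exact_mod_cast h₂
      rw [← mul_div_assoc, div_le_div_iff₀ (by positivity) (by positivity)]
      have hp : (0 : ℝ) < 2 ^ s := by positivity
      nlinarith
  refine ⟨Nat.pair t m, by simp, ?_, ?_⟩
  · simp only [eventWeight, Nat.unpair_pair]
    linarith
  · simp only [eventWeight, Nat.unpair_pair]
    by_contra h0
    rw [Nat.eq_zero_of_not_pos h0] at ht
    norm_num at ht
    linarith

end SDMachine

/-! ### The decoding machine and the coding theorem -/

/-- Reversal makes the first program bit the most significant one, so `bitsCode s.reverse / 2 ^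
s.length` is the binary number `1.s`. Extending `s` shrinks its cylinder, shifted by 1 throughout.
-/
theorem bitsCode_reverse_prefix (s t : List Bool) :
    (bitsCode s.reverse : ℝ) / 2 ^ s.length ≤ bitsCode (s ++ t).reverse / 2 ^ (s ++ t).length ∧
    ((bitsCode (s ++ t).reverse : ℝ) + 1) / 2 ^ (s ++ t).length ≤
      (bitsCode s.reverse + 1) / 2 ^ s.length := by
  have h := bitsCode_append t.reverse s.reverse
  have h₁ := two_pow_le_bitsCode t.reverse
  have h₂ := bitsCode_lt t.reverse
  rw [List.length_reverse] at h h₁ h₂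
  rw [pow_succ] at h₂
  rw [List.reverse_append, List.length_append, pow_add]
  have h₃ : bitsCode s.reverse * 2 ^ t.length ≤ bitsCode (t.reverse ++ s.reverse) := by nlinarith
  have h₄ : bitsCode (t.reverse ++ s.reverse) + 1 ≤ (bitsCode s.reverse + 1) * 2 ^ t.length := by
    nlinarith
  have h₃' : (bitsCode s.reverse * 2 ^ t.length : ℝ) ≤ bitsCode (t.reverse ++ s.reverse) := by
    exact_mod_cast h₃
  have h₄' : (bitsCode (t.reverse ++ s.reverse) + 1 : ℝ) ≤
      (bitsCode s.reverse + 1) * 2 ^ t.length := by exact_mod_cast h₄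
  have hs : (0 : ℝ) < 2 ^ s.length := by positivity
  have ht : (0 : ℝ) < 2 ^ t.length := by positivity
  constructor
  · rw [div_le_div_iff₀ hs (by positivity)]
    nlinarith
  · rw [div_le_div_iff₀ (by positivity) hs]
    nlinarith

/-- A list with the property `B` has a shortest prefix with this property. -/
theorem List.exists_minimal_prefix {α : Type*} {A B : List α → Prop} {r : List α}
    (h : ∀ s t, r = s ++ t → A s ∨ B s) (hr : B r) :
    ∃ s t, r = s ++ t ∧ B s ∧ ∀ u b v, s = u ++ b :: v → A u := by
  classical
  have hex : ∃ n, ∃ s t, r = s ++ t ∧ s.length = n ∧ B s := ⟨_, r, [], by simp, rfl, hr⟩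
  obtain ⟨s, t, rfl, hl, hs⟩ := Nat.find_spec hex
  refine ⟨s, t, rfl, hs, fun u b v e => ?_⟩
  refine (h u (b :: v ++ t) (by simp [e])).resolve_right fun hu => ?_
  have : u.length < Nat.find hex := by rw [← hl, e]; simp
  exact Nat.find_min hex this ⟨u, b :: v ++ t, by simp [e], rfl, hu⟩

namespace SDMachine

variable (U : SDMachine) (b : ℕ)

/-- This is the search test of `decodeStep` with denominators cleared; the summand 1 on the right
matches the leading digit of `a`. -/
theorem cylinder_lt_iff (a n : ℕ) :
    a * 2 ^ (n + 1) < 2 ^ a.log2 * (U.totalWeight b (n + 1) + 2 ^ (n + 1)) ↔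
      (a : ℝ) / 2 ^ a.log2 < U.weightBelow b (n + 1) + 1 := by
  have h₁ : (0 : ℝ) < 2 ^ (n + 1) := by positivity
  have h₂ : (0 : ℝ) < 2 ^ a.log2 := by positivity
  rw [weightBelow, div_add_one h₁.ne', div_lt_div_iff₀ h₂ h₁,
    mul_comm _ ((2 : ℝ) ^ a.log2)]
  exact_mod_cast Iff.rfl

theorem cylinder_le_iff (a n : ℕ) :
    (a + 1) * 2 ^ (n + 1) ≤ 2 ^ a.log2 * (U.totalWeight b (n + 1) + 2 ^ (n + 1)) ↔
      ((a : ℝ) + 1) / 2 ^ a.log2 ≤ U.weightBelow b (n + 1) + 1 := by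
  have h₁ : (0 : ℝ) < 2 ^ (n + 1) := by positivity
  have h₂ : (0 : ℝ) < 2 ^ a.log2 := by positivity
  rw [weightBelow, div_add_one h₁.ne', div_le_div_iff₀ h₂ h₁,
    mul_comm _ ((2 : ℝ) ^ a.log2)]
  exact_mod_cast Iff.rfl

open Classical in
theorem exists_mem_decodeStep {a n : ℕ} (h : (a : ℝ) / 2 ^ a.log2 < U.weightBelow b (n + 1) + 1) :
    ∃ k ≤ n, (a : ℝ) / 2 ^ a.log2 < U.weightBelow b (k + 1) + 1 ∧
      (if ((a : ℝ) + 1) / 2 ^ a.log2 ≤ U.weightBelow b (k + 1) + 1 then k.unpair.2 + 1 else 0) ∈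
        U.decodeStep a b := by
  have hex : ∃ n, (a : ℝ) / 2 ^ a.log2 < U.weightBelow b (n + 1) + 1 := ⟨n, h⟩
  refine ⟨Nat.find hex, Nat.find_min' hex h, Nat.find_spec hex, ?_⟩
  refine (Part.mem_map_iff _).2 ⟨Nat.find hex, ?_, ?_⟩
  · refine Nat.mem_rfind.2 ⟨Part.mem_some_iff.2 ?_, fun hm => Part.mem_some_iff.2 ?_⟩
    · exact (decide_eq_true ((U.cylinder_lt_iff b a _).2 (Nat.find_spec hex))).symm
    · exact (decide_eq_false ((U.cylinder_lt_iff b a _).not.2 (Nat.find_min hex hm))).symm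
  · simp only [cylinder_le_iff]

/-- A program in the interval of the `n`-th event has a prefix with which the decoding machine
prints the output of this event. -/
theorem exists_decodeStep_of_cylinder {n : ℕ} {r : List Bool}
    (h₁ : U.weightBelow b n + 1 ≤ (bitsCode r.reverse : ℝ) / 2 ^ r.length)
    (h₂ : ((bitsCode r.reverse : ℝ) + 1) / 2 ^ r.length ≤ U.weightBelow b (n + 1) + 1) :
    ∃ s : List Bool, s.length ≤ r.length ∧
      n.unpair.2 + 1 ∈ U.decodeStep (bitsCode s.reverse) b ∧
      ∀ u c v, s = u ++ c :: v → 0 ∈ U.decodeStep (bitsCode u.reverse) b := by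
  have hlog : ∀ s : List Bool, (bitsCode s.reverse).log2 = s.length := fun s => by
    rw [log2_bitsCode, List.length_reverse]
  have hlt : (bitsCode r.reverse : ℝ) / 2 ^ r.length < U.weightBelow b (n + 1) + 1 := by
    refine lt_of_lt_of_le ?_ h₂
    gcongr
    linarith
  -- The search on a prefix `s` stops at some `k ≤ n`. If it prints with `k < n`, the cylinder of
  -- `r` ends before the `n`-th interval begins, contradicting `h₁`. So no prefix prints a wrong
  -- output, and the shortest one that prints is the program sought.
  have key : ∀ s t, r = s ++ t → 0 ∈ U.decodeStep (bitsCode s.reverse) b ∨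
      n.unpair.2 + 1 ∈ U.decodeStep (bitsCode s.reverse) b := by
    rintro s t rfl
    obtain ⟨hs, hs'⟩ := bitsCode_reverse_prefix s t
    obtain ⟨k, hk, -, hmem⟩ := U.exists_mem_decodeStep b (a := bitsCode s.reverse) (n := n)
      (by rw [hlog]; exact hs.trans_lt hlt)
    rw [hlog] at hmem
    split_ifs at hmem with hc
    · right
      rcases hk.lt_or_eq with hk | rfl
      · have h₃ := U.weightBelow_mono b (show k + 1 ≤ n from hk)
        have h₄ : (bitsCode (s ++ t).reverse : ℝ) / 2 ^ (s ++ t).length <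
            ((bitsCode (s ++ t).reverse : ℝ) + 1) / 2 ^ (s ++ t).length := by
          gcongr
          linarith
        linarith
      · exact hmem
    · exact Or.inl hmem
  have hr : n.unpair.2 + 1 ∈ U.decodeStep (bitsCode r.reverse) b := by
    obtain ⟨k, hk, hk', hmem⟩ := U.exists_mem_decodeStep b (a := bitsCode r.reverse) (n := n)
      (by rw [hlog]; exact hlt)
    rw [hlog] at hmem hk'
    rcases hk.lt_or_eq with hk | rfl
    · have h₃ := U.weightBelow_mono b (show k + 1 ≤ n from hk)
      linarith
    · rwa [if_pos h₂] at hmem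
  obtain ⟨s, t, rfl, hs, hu⟩ := List.exists_minimal_prefix
    (A := fun s => 0 ∈ U.decodeStep (bitsCode s.reverse) b) key hr
  exact ⟨s, by simp, hs, hu⟩

/-- Every interval contains a cylinder of at least a quarter of its length. -/
theorem exists_cylinder {n : ℕ} (h : 0 < U.eventWeight b n) :
    ∃ r : List Bool, U.weightBelow b n + 1 ≤ (bitsCode r.reverse : ℝ) / 2 ^ r.length ∧
      ((bitsCode r.reverse : ℝ) + 1) / 2 ^ r.length ≤ U.weightBelow b (n + 1) + 1 ∧
      (U.eventWeight b n : ℝ) / 2 ^ n.unpair.1 ≤ 4 * (2⁻¹ : ℝ) ^ r.length := by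
  classical
  set w : ℝ := (U.eventWeight b n : ℝ) / 2 ^ n.unpair.1 with hw
  have hw0 : 0 < w := by rw [hw]; positivity
  have hsucc : U.weightBelow b (n + 1) = U.weightBelow b n + w := weightBelow_succ U b n
  have h0 := U.weightBelow_nonneg b n
  have h1 := U.weightBelow_le_one b (n + 1)
  -- Cells of at most half the length of the interval guarantee that one fits inside; the least such
  -- `l` gives cells of at least a quarter.
  have hex : ∃ l : ℕ, (2⁻¹ : ℝ) ^ l ≤ w / 2 := by
    obtain ⟨l, hl⟩ := exists_pow_lt_of_lt_one (half_pos hw0) (by norm_num : (2⁻¹ : ℝ) < 1)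
    exact ⟨l, hl.le⟩
  obtain ⟨l, hl⟩ : ∃ l, l = Nat.find hex := ⟨_, rfl⟩
  have hl₁ : (2⁻¹ : ℝ) ^ l ≤ w / 2 := hl ▸ Nat.find_spec hex
  have hl₂ : w ≤ 4 * (2⁻¹ : ℝ) ^ l := by
    rcases l with _ | l
    · simp; linarith
    · have : ¬ (2⁻¹ : ℝ) ^ l ≤ w / 2 := Nat.find_min hex (by omega)
      rw [pow_succ]
      linarith
  have hp : (0 : ℝ) < 2 ^ l := by positivity
  rw [inv_pow, inv_eq_one_div, div_le_iff₀ hp] at hl₁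
  -- The first cell beginning in the interval: rounding up loses less than one cell, and two cells
  -- fit.
  obtain ⟨v, hv⟩ : ∃ v : ℕ, v = ⌈U.weightBelow b n * 2 ^ l⌉₊ := ⟨_, rfl⟩
  have hv₁ : U.weightBelow b n * 2 ^ l ≤ v := hv ▸ Nat.le_ceil _
  have hv₂ : (v : ℝ) < U.weightBelow b n * 2 ^ l + 1 :=
    hv ▸ Nat.ceil_lt_add_one (by positivity)
  have hv₃ : (v : ℝ) + 1 ≤ U.weightBelow b (n + 1) * 2 ^ l := by rw [hsucc]; nlinarith
  have hvl : v < 2 ^ l := by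
    have : (v : ℝ) < 2 ^ l := by nlinarith
    exact_mod_cast this
  have hlen : (decodeBits (2 ^ l + v)).reverse.length = l := by
    rw [List.length_reverse, length_decodeBits, log2_two_pow_add hvl]
  refine ⟨(decodeBits (2 ^ l + v)).reverse, ?_⟩
  rw [hlen, List.reverse_reverse, bitsCode_decodeBits (by positivity)]
  push_cast
  refine ⟨?_, ?_, hl₂⟩
  · rw [le_div_iff₀ hp]
    nlinarith
  · rw [div_le_iff₀ hp]
    nlinarith

/-- The decoding machine has, for every output, programs as short as the counted programs of `U`
permit. -/
theorem exists_decoder : ∃ T : SDMachine, ∀ (x y : List Bool) (t : ℕ),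
    0 < U.outCount (bitsCode y) t (bitsCode x) →
    ∃ p, x ∈ T.run p y ∧
      (U.outCount (bitsCode y) t (bitsCode x) : ℝ) / 2 ^ t ≤ 16 * (2⁻¹ : ℝ) ^ p.length := by
  obtain ⟨T, hT⟩ := exists_machine_of_partrec U.partrec_decodeStep
  refine ⟨T, fun x y t h => ?_⟩
  obtain ⟨m, hm⟩ : ∃ m, bitsCode x = m + 1 := ⟨bitsCode x - 1, by have := bitsCode_pos x; omega⟩
  rw [hm] at h ⊢
  obtain ⟨n, hn, hle, hpos⟩ := U.exists_outCount_le_eventWeight (bitsCode y) t h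
  obtain ⟨r, hr₁, hr₂, hr₃⟩ := U.exists_cylinder (bitsCode y) hpos
  obtain ⟨p, hp, hmem, hpre⟩ := U.exists_decodeStep_of_cylinder (bitsCode y) hr₁ hr₂
  refine ⟨p, hT p x y hpre (by rwa [hm, ← hn]), ?_⟩
  have : (2⁻¹ : ℝ) ^ r.length ≤ (2⁻¹ : ℝ) ^ p.length :=
    pow_le_pow_of_le_one (by norm_num) (by norm_num) hp
  -- One factor 4 comes from the choice of the event and one from the choice of the cylinder.
  linarith

/-- A finite part of the sum defining `P` is bounded by the proportion of the programs of some
length that produce the output. -/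
theorem exists_sum_le_outCount (x y : List Bool) (F : Finset {p : List Bool // x ∈ U.run p y}) :
    ∃ t, ∑ p ∈ F, (2 : ℝ≥0∞)⁻¹ ^ p.1.length ≤
      ENNReal.ofReal ((U.outCount (bitsCode y) t (bitsCode x) : ℝ) / 2 ^ t) := by
  choose t₀ ht₀ using fun p : {p : List Bool // x ∈ U.run p y} => exists_outCode_eq p.2
  obtain ⟨t, ht⟩ : ∃ t, ∀ p ∈ F, p.1.length ≤ t ∧ t₀ p ≤ t := by
    refine ⟨F.sup fun p => max p.1.length (t₀ p), fun p hp => ?_⟩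
    have := Finset.le_sup (f := fun p => max p.1.length (t₀ p)) hp
    exact ⟨(le_max_left _ _).trans this, (le_max_right _ _).trans this⟩
  refine ⟨t, ?_⟩
  have hcard : ∑ p ∈ F, 2 ^ (t - p.1.length) ≤ U.outCount (bitsCode y) t (bitsCode x) := by
    have : ∑ p ∈ F, 2 ^ (t - p.1.length) =
        (F.sigma fun p => (Finset.univ : Finset (Fin (t - p.1.length) → Bool))).card := by
      simp [Finset.card_sigma]
    rw [this, outCount]
    have hlen : ∀ p ∈ F, ∀ g : Fin (t - p.1.length) → Bool,
        (p.1 ++ List.ofFn g).length = t := fun p hp g => by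
      have := (ht p hp).1
      simp; omega
    have hrange : ∀ p ∈ F, ∀ g : Fin (t - p.1.length) → Bool,
        bitsCode (p.1 ++ List.ofFn g) - 2 ^ t < 2 ^ t ∧
        2 ^ t + (bitsCode (p.1 ++ List.ofFn g) - 2 ^ t) = bitsCode (p.1 ++ List.ofFn g) :=
      fun p hp g => by
        have h₁ := two_pow_le_bitsCode (p.1 ++ List.ofFn g)
        have h₂ := bitsCode_lt (p.1 ++ List.ofFn g)
        rw [hlen p hp g] at h₁ h₂
        rw [pow_succ] at h₂
        omega
    -- Every program in `F` is padded in all ways to length `t`; by prefix-freeness the padded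
    -- strings are distinct.
    refine Finset.card_le_card_of_injOn (fun z => bitsCode (z.1.1 ++ List.ofFn z.2) - 2 ^ t) ?_ ?_
    · rintro ⟨p, g⟩ hz
      have hp : p ∈ F := (Finset.mem_sigma.1 hz).1
      simp only [Finset.coe_filter, Finset.mem_range, Set.mem_ofPred_eq]
      rw [(hrange p hp g).2, decodeBits_bitsCode, decodeBits_bitsCode]
      exact ⟨(hrange p hp g).1, ht₀ p _ t (ht p hp).2⟩
    · rintro ⟨p, g⟩ hz ⟨p', g'⟩ hz' h
      have hp : p ∈ F := (Finset.mem_sigma.1 hz).1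
      have hp' : p' ∈ F := (Finset.mem_sigma.1 hz').1
      have e : p.1 ++ List.ofFn g = p'.1 ++ List.ofFn g' := by
        apply bitsCode_injective
        rw [← (hrange p hp g).2, ← (hrange p' hp' g').2]
        exact congrArg _ h
      obtain rfl : p = p' := Subtype.ext (eq_of_append_eq p.2 p'.2 e)
      rw [List.append_cancel_left_eq] at e
      rw [List.ofFn_injective e]
  have hsum : ∑ p ∈ F, (2 : ℝ≥0∞)⁻¹ ^ p.1.length =
      ENNReal.ofReal (∑ p ∈ F, (2⁻¹ : ℝ) ^ p.1.length) := by
    rw [ENNReal.ofReal_sum_of_nonneg fun p _ => by positivity]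
    refine Finset.sum_congr rfl fun p _ => ?_
    rw [ENNReal.ofReal_pow (by norm_num), ENNReal.ofReal_inv_of_pos (by norm_num)]
    simp
  rw [hsum]
  refine ENNReal.ofReal_le_ofReal ?_
  rw [le_div_iff₀ (by positivity), Finset.sum_mul]
  calc ∑ p ∈ F, (2⁻¹ : ℝ) ^ p.1.length * 2 ^ t
      = ∑ p ∈ F, (2 : ℝ) ^ (t - p.1.length) := by
        refine Finset.sum_congr rfl fun p hp => ?_
        rw [pow_sub₀ _ (by norm_num) (ht p hp).1, inv_pow, mul_comm]
    _ ≤ _ := by exact_mod_cast hcard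

theorem P_le_of_forall_outCount {x y : List Bool} {C : ℝ}
    (h : ∀ t, (U.outCount (bitsCode y) t (bitsCode x) : ℝ) / 2 ^ t ≤ C) :
    U.P x y ≤ ENNReal.ofReal C := by
  rw [P, ENNReal.tsum_eq_iSup_sum]
  refine iSup_le fun F => ?_
  obtain ⟨t, ht⟩ := U.exists_sum_le_outCount x y F
  exact ht.trans (ENNReal.ofReal_le_ofReal (h t))

/-- The machine printing a fixed string. -/
def printer (x : List Bool) : SDMachine where
  Q := Fin (x.length + 1)
  finite_Q := inferInstance
  start := 0
  rule i _ _ := if h : (i : ℕ) < x.length then some (.out x[i], ⟨i + 1, by omega⟩) else none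

theorem mem_run_printer (x y : List Bool) : x ∈ (printer x).run [] y := by
  have key : ∀ n (h : n < x.length + 1), StateTransition.Reaches ((printer x).step [])
      ((printer x).init y) ⟨⟨n, h⟩, 0, ((printer x).init y).work, x.take n⟩ := by
    intro n
    induction n with
    | zero => exact fun _ => Relation.ReflTransGen.refl
    | succ n ih =>
      intro h
      refine Relation.ReflTransGen.tail (ih (by omega)) ?_
      have hn : n < x.length := by omega
      simp [step, printer, act, hn]
      rfl
  simp only [run, Part.mem_bind_iff, Part.mem_assert_iff, Part.mem_some_iff,
    StateTransition.mem_eval]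
  refine ⟨_, ⟨key x.length (Nat.lt_succ_self _), ?_⟩, rfl, by simp⟩
  simp [step, printer]

variable {U}

theorem K_le {x y p : List Bool} (h : x ∈ U.run p y) : U.K x y ≤ p.length :=
  iInf_le (fun p : {p : List Bool // x ∈ U.run p y} => (p.1.length : ℕ∞)) ⟨p, h⟩

theorem exists_K_eq {x y p : List Bool} (h : x ∈ U.run p y) :
    ∃ p, x ∈ U.run p y ∧ U.K x y = p.length := by
  have : Nonempty {p : List Bool // x ∈ U.run p y} := ⟨⟨p, h⟩⟩
  obtain ⟨q, hq⟩ := ENat.exists_eq_iInf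
    (fun p : {p : List Bool // x ∈ U.run p y} => (p.1.length : ℕ∞))
  exact ⟨q.1, q.2, hq.symm⟩

end SDMachine

theorem mainTheorem1 (U : SDMachine) (hU : U.IsUniversal) :
    ∃ c : ℝ, ∀ x y : List Bool,
      U.K x y ≠ ⊤ ∧ U.P x y ≠ 0 ∧ U.P x y ≠ ⊤ ∧
        |((U.K x y).toNat : ℝ) - (-Real.logb 2 (U.P x y).toReal)| ≤ c := by
  obtain ⟨T, hT⟩ := U.exists_decoder
  obtain ⟨r, hr⟩ := hU T
  refine ⟨r.length + 4, fun x y => ?_⟩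
  -- The preamble `r₀` depends on `x`, which is harmless: it serves only to show that some program
  -- for `x` exists.
  obtain ⟨r₀, hr₀⟩ := hU (SDMachine.printer x)
  have h₀ : x ∈ U.run (r₀ ++ []) y := by rw [hr₀]; exact SDMachine.mem_run_printer x y
  obtain ⟨p, hp, hK⟩ := SDMachine.exists_K_eq h₀
  have hlow : (2 : ℝ≥0∞)⁻¹ ^ p.length ≤ U.P x y :=
    ENNReal.le_tsum (f := fun p : {p : List Bool // x ∈ U.run p y} => (2 : ℝ≥0∞)⁻¹ ^ p.1.length)
      ⟨p, hp⟩
  -- A program `q` of the decoder yields the program `r ++ q` of `U`, which is no shorter than the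
  -- shortest program `p`.
  have hhigh : U.P x y ≤ ENNReal.ofReal (16 * 2 ^ r.length * (2⁻¹ : ℝ) ^ p.length) := by
    refine U.P_le_of_forall_outCount fun t => ?_
    rcases Nat.eq_zero_or_pos (U.outCount (bitsCode y) t (bitsCode x)) with h | h
    · rw [h, Nat.cast_zero, zero_div]
      positivity
    · obtain ⟨q, hq, hle⟩ := hT x y t h
      have hlen : p.length ≤ r.length + q.length := by
        have := SDMachine.K_le (U := U) (p := r ++ q) (x := x) (y := y) (by rwa [hr])
        rw [hK, List.length_append] at this
        exact_mod_cast this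
      refine hle.trans ?_
      rw [mul_assoc]
      refine mul_le_mul_of_nonneg_left ?_ (by norm_num)
      rw [inv_pow, inv_pow, inv_eq_one_div, ← div_eq_mul_inv,
        div_le_div_iff₀ (by positivity) (by positivity), one_mul, ← pow_add]
      exact pow_le_pow_right₀ (by norm_num) hlen
  have htop : U.P x y ≠ ⊤ := (hhigh.trans_lt ENNReal.ofReal_lt_top).ne
  have hpos : U.P x y ≠ 0 := fun h => by
    rw [h, nonpos_iff_eq_zero] at hlow
    simp at hlow
  refine ⟨by rw [hK]; exact ENat.natCast_ne_top _, hpos, htop, ?_⟩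
  have hlow' : (2⁻¹ : ℝ) ^ p.length ≤ (U.P x y).toReal := by
    have := ENNReal.toReal_mono htop hlow
    simpa using this
  have hhigh' : (U.P x y).toReal ≤ 16 * 2 ^ r.length * (2⁻¹ : ℝ) ^ p.length :=
    ENNReal.toReal_le_of_le_ofReal (by positivity) hhigh
  have hpos' : 0 < (U.P x y).toReal := ENNReal.toReal_pos hpos htop
  have hl₁ : -(p.length : ℝ) ≤ Real.logb 2 (U.P x y).toReal := by
    rw [Real.le_logb_iff_rpow_le (by norm_num) hpos', Real.rpow_neg (by norm_num),
      Real.rpow_natCast, ← inv_pow]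
    exact hlow'
  have hl₂ : Real.logb 2 (U.P x y).toReal ≤ r.length + 4 - p.length := by
    rw [Real.logb_le_iff_le_rpow (by norm_num) hpos', Real.rpow_sub (by norm_num),
      Real.rpow_add (by norm_num), Real.rpow_natCast, Real.rpow_natCast]
    refine hhigh'.trans (le_of_eq ?_)
    rw [inv_pow, div_eq_mul_inv]
    norm_num
    ring
  rw [hK, ENat.toNat_natCast, abs_le]
  constructor <;> linarith [(Nat.cast_nonneg r.length : (0 : ℝ) ≤ r.length)]
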